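/- Let $d\in\mathbb N$, $M\in\mathbb N_{\ge 2}$, $r:=1/M$ and $p\in(1/M,1]$. Divide $J:=[0,1]^d$ into the $M^d$ closed subcubes $J_1,\dots,J_{M^d}$ of side length $r$, let $\phi_j$ be the rotation- and reflection-free similarity with $\phi_j(J)=J_j$, and for a word $\sigma=\sigma_1\cdots\sigma_n$ over $\{1,\dots,M^d\}$ let $J_\sigma:=\phi_{\sigma_1}\circ\cdots\circ\phi_{\sigma_n}(J)$. In fractal percolation with parameters $M$ and $p$, each cube $J_{\sigma i}$ ($\sigma$ any finite word, including the empty one, $i\in\{1,\dots,M^d\}$) is kept with probability $p$ when $J_\sigma$ is divided, independently of all the others. Let $\mathcal T_n$ be the random set of words $\sigma$ of length $n$ such that $J_{\sigma_1\cdots\sigma_i}$ is kept for every $i\in\{1,\dots,n\}$, and put $$F_n:=\bigcup_{\sigma\in\mathcal T_n}J_\sigma,\qquad C_n:=\overline{J\setminus F_n},\qquad C_n^j:=\bigcup\{J_\sigma:\ |\sigma|=n,\ \sigma_1=j,\ \sigma\notin\mathcal T_n\}\quad(n\ge1,\ 1\le j\le M^d).$$ Let $D:=\log(M^dp)/\log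 M$ (the Minkowski dimension of $F=\bigcap_nF_n$, almost surely on $F\neq\emptyset$). Let $V_0,\dots,V_d$ be the intrinsic volumes, that is, the coefficients in the Steiner formula $\mathrm{vol}(K_{\oplus\varepsilon})=\sum_{k=0}^d\omega_{d-k}V_k(K)\varepsilon^{d-k}$ for compact convex $K\subset\mathbb R^d$ (where $K_{\oplus\varepsilon}$ is the closed $\varepsilon$-parallel set of $K$ and $\omega_m$ the volume of the unit ball of $\mathbb R^m$), extended additively to finite unions of compact convex sets; put $q_{d,k}:=V_k([0,1]^d)$. Then for each $k\in\{0,\dots,d\}$ with $k<D$, all expectations and series below are well defined, the series converging absolutely, and the limit $\lim_{n\to\infty}r^{n(D-k)}\,\mathbb E V_k(C_n)$ exists and equals $$q_{d,k}\,\frac{M^{d-k}(1-p)}{M^{d-k}p-1}+\sum_{T\subset\{1,\dots,M^d\},\,|T|\ge2}(-1)^{|T|-1}\sum_{n=1}^\infty r^{n(D-k)}\,\mathbb E V_k\Big(\bigcap_{j\in T}C_n^j\Big).$$ -/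

import Mathlib

open MeasureTheory ProbabilityTheory Filter Topology

noncomputable section

namespace FractalPercolation

/-! ### Intrinsic volumes of polyconvex sets -/

/-- The volume `ω_m` of the unit ball of `ℝ^m`. -/
def unitBallVolume (m : ℕ) : ℝ :=
  volume.real (Metric.closedBall (0 : EuclideanSpace ℝ (Fin m)) 1)

/-- `v = (v_0, …, v_d)` are the coefficients in the Steiner formula of `K`: for every `ε ≥ 0`, the
volume of the closed `ε`-parallel set of `K` is `∑_k ω_{d-k} v_k ε^(d-k)`. -/
def SteinerFormula {d : ℕ} (K : Set (EuclideanSpace ℝ (Fin d))) (v : Fin (d + 1) → ℝ) : Prop :=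
  ∀ ε : ℝ, 0 ≤ ε →
    volume.real (Metric.cthickening ε K) =
      ∑ k : Fin (d + 1), unitBallVolume (d - (k : ℕ)) * v k * ε ^ (d - (k : ℕ))

/-- `v = (v_0, …, v_d)` are the intrinsic volumes of the compact polyconvex set `K`: for a compact
convex set they are the coefficients in the Steiner formula, and they are extended to finite unions
of compact convex sets by additivity. -/
inductive HasIntrinsicVolumes {d : ℕ} :
    Set (EuclideanSpace ℝ (Fin d)) → (Fin (d + 1) → ℝ) → Prop
  | convex {K : Set (EuclideanSpace ℝ (Fin d))} {v : Fin (d + 1) → ℝ}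
      (hc : IsCompact K) (hK : Convex ℝ K) (hv : SteinerFormula K v) :
      HasIntrinsicVolumes K v
  | union {K L : Set (EuclideanSpace ℝ (Fin d))} {v w u : Fin (d + 1) → ℝ}
      (hK : HasIntrinsicVolumes K v) (hL : HasIntrinsicVolumes L w)
      (hKL : HasIntrinsicVolumes (K ∩ L) u) :
      HasIntrinsicVolumes (K ∪ L) (v + w - u)

open Classical in
/-- The `k`-th intrinsic volume `V_k(K)` of a compact polyconvex set `K ⊆ ℝ^d`
(and `0` for all other sets). -/
def intrinsicVolume {d : ℕ} (k : Fin (d + 1)) (K : Set (EuclideanSpace ℝ (Fin d))) : ℝ :=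
  if h : ∃ v, HasIntrinsicVolumes K v then h.choose k else 0

/-! ### The cubes -/

/-- The labels of the `M^d` subcubes into which the unit cube is divided: the subcube with label
`j` has lower corner `j / M`. -/
abbrev Label (d M : ℕ) : Type := Fin d → Fin M

/-- The unit cube `J = [0,1]^d`. -/
def unitCube (d : ℕ) : Set (EuclideanSpace ℝ (Fin d)) := {x | ∀ i, x i ∈ Set.Icc (0 : ℝ) 1}

/-- The similarity `φ_j` mapping `J` to its subcube with label `j`. -/
def subcubeMap {d M : ℕ} (j : Label d M) (x : EuclideanSpace ℝ (Fin d)) :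
    EuclideanSpace ℝ (Fin d) :=
  WithLp.toLp 2 (fun i => (x i + ((j i : ℕ) : ℝ)) / (M : ℝ))

/-- The cube `J_σ = φ_{σ_1} ∘ … ∘ φ_{σ_n} (J)` of level `n` coded by the word `σ = σ_1 … σ_n`. -/
def cube {d M : ℕ} : List (Label d M) → Set (EuclideanSpace ℝ (Fin d))
  | [] => unitCube d
  | j :: σ => subcubeMap j '' cube σ

/-! ### Fractal percolation

`I σ ω` is the (random) set of the labels of those subcubes of `J_σ` that are kept when `J_σ` is
divided. -/

/-- Every subcube of every cube is kept with probability `p`, independently of all others. -/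
structure IsPercolation {Ω : Type*} [MeasurableSpace Ω] (μ : Measure Ω) {d M : ℕ} (p : ℝ)
    (I : List (Label d M) → Ω → Set (Label d M)) : Prop where
  measurableSet : ∀ σ j, MeasurableSet {ω | j ∈ I σ ω}
  prob : ∀ σ j, μ {ω | j ∈ I σ ω} = ENNReal.ofReal p
  indep : iIndepSet (fun q : List (Label d M) × Label d M => {ω | q.2 ∈ I q.1 ω}) μ

/-- The `n`-th generation `𝒯_n` of the random tree: the words of the cubes of level `n` that have
been kept in all of the first `n` steps. -/
def tree {Ω : Type*} {d M : ℕ} (I : List (Label d M) → Ω → Set (Label d M)) (ω : Ω) :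
    ℕ → Set (List (Label d M))
  | 0 => {[]}
  | n + 1 => {τ | ∃ σ ∈ tree I ω n, ∃ i ∈ I σ ω, τ = σ ++ [i]}

/-- The `n`-th construction step `F_n` of fractal percolation. -/
def stepSet {Ω : Type*} {d M : ℕ} (I : List (Label d M) → Ω → Set (Label d M)) (n : ℕ) (ω : Ω) :
    Set (EuclideanSpace ℝ (Fin d)) :=
  ⋃ σ ∈ tree I ω n, cube σ

/-- The closed complement `C_n`, the closure of `J \ F_n`. -/
def complSet {Ω : Type*} {d M : ℕ} (I : List (Label d M) → Ω → Set (Label d M)) (n : ℕ) (ω : Ω) :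
    Set (EuclideanSpace ℝ (Fin d)) :=
  closure (unitCube d \ stepSet I n ω)

/-- The part `C_n^j` of `C_n` in the subcube `J_j`: the union of the cubes `J_σ` over all words `σ`
of length `n` with first letter `j` that do not belong to `𝒯_n`. -/
def complPart {Ω : Type*} {d M : ℕ} (I : List (Label d M) → Ω → Set (Label d M)) (n : ℕ)
    (j : Label d M) (ω : Ω) : Set (EuclideanSpace ℝ (Fin d)) :=
  ⋃ σ ∈ {σ : List (Label d M) | σ.length = n ∧ σ.head? = some j ∧ σ ∉ tree I ω n}, cube σ

/-- The number `D = log (M^d p) / log M`, the dimension of fractal percolation. -/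
def dimension (d M : ℕ) (p : ℝ) : ℝ := Real.log ((M : ℝ) ^ d * p) / Real.log M

end FractalPercolation

end

/-! The proof is a renewal argument. The closed complement `C_n` is the union of the level-`n` cubes
that are not kept (`complSet_eq_removedSet`), hence the union of the parts `C_n^j`.
Inclusion-exclusion expresses `V_k(C_n)` through the intersections of these parts. For a single `j`,
the part is all of `J_j` if `J_j` is discarded; otherwise it is a copy, scaled by `1/M`, of the
complement of level `n - 1` of a percolation with the same law, independent of the decision about
`J_j`. Since `V_k` is homogeneous of degree `k` and there are `M^d` labels, with `q = V_k(J)`, `E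
V_k(C_{n+1}) = M^(d-k) (p E V_k(C_n) + (1-p) q) + (terms with |T| ≥ 2)`.

Put `c = M^(d-k) p`. Then `r^(D-k) = c⁻¹`, and `k < D` gives `c > 1`. After multiplication by
`c^(-n)` the recursion only adds a summand at each step, and `C_0 = ∅`, so the rescaled expectations
are partial sums of a series. The `q`-terms form a geometric series, which gives the first term of
the limit. For `|T| ≥ 2` the intersection lies in a grid hyperplane, so it consists of
`O(M^(n(d-1)))` grid cells and its `V_k` is `O(M^(n(d-1-k)))`. Rescaling turns this into `O((M
p)^(-n))`, which is summable because `p > 1/M`.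

Two geometric facts are needed. First, `intrinsicVolume` picks some vector admitted by
`HasIntrinsicVolumes`, so uniqueness has to be shown: a linear relation between indicators of
compact convex sets passes to their parallel sets, by the Euler characteristic applied to
intersections with balls, and so to the Steiner coefficients. Second, `V_k` of a union of cells is
bounded by the number of cells: adding a cell changes `V_k` by its value on the cell minus its value
on the overlap, and up to scaling only finitely many overlaps occur, namely unions of faces of the
unit cube. -/

noncomputable section

namespace FractalPercolation

section

/-! ### The Euler characteristic relation -/

open Classical in
/-- A linear relation between indicators of compact intervals is a relation between the
coefficients of the nonempty ones. -/
theorem sum_nonempty_eq_zero_of_real {ι : Type*} [Fintype ι] (a : ι → ℝ) (S : ι → Set ℝ)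
    (hc : ∀ i, IsCompact (S i)) (hS : ∀ i, Convex ℝ (S i))
    (h : ∀ t, ∑ i, (S i).indicator (fun _ => a i) t = 0) :
    ∑ i, (if (S i).Nonempty then a i else 0) = 0 := by
  -- The value at `t` minus the value just to the right of `t` detects exactly the intervals whose
  -- right endpoint is `t`. Summing over `t` then counts each nonempty interval once.
  have key : ∀ t : ℝ, ∑ i, (if (S i).Nonempty ∧ sSup (S i) = t then a i else 0) = 0 := by
    intro t
    have ev : ∀ i, ∀ᶠ s in 𝓝[>] t,
        (S i).indicator (fun _ => a i) t - (S i).indicator (fun _ => a i) s =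
          if (S i).Nonempty ∧ sSup (S i) = t then a i else 0 := by
      intro i
      by_cases ht : t ∈ S i
      · have hne : (S i).Nonempty := ⟨t, ht⟩
        have hle : t ≤ sSup (S i) := le_csSup (hc i).bddAbove ht
        rcases hle.eq_or_lt with heq | hlt
        · filter_upwards [self_mem_nhdsWithin] with s hs
          have : s ∉ S i := fun hmem =>
            absurd (le_csSup (hc i).bddAbove hmem) (by rw [← heq]; exact not_le.2 hs)
          simp [ht, this, hne, ← heq]
        · filter_upwards [Ioc_mem_nhdsGT hlt] with s hs
          have : s ∈ S i :=
            (hS i).ordConnected.out ht ((hc i).sSup_mem hne) ⟨hs.1.le, hs.2⟩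
          simp [ht, this, hlt.ne']
      · have hne : ¬ ((S i).Nonempty ∧ sSup (S i) = t) := fun ⟨h1, h2⟩ =>
          ht (h2 ▸ (hc i).sSup_mem h1)
        have : ∀ᶠ s in 𝓝[>] t, s ∉ S i :=
          nhdsWithin_le_nhds ((hc i).isClosed.isOpen_compl.mem_nhds ht)
        filter_upwards [this] with s hs
        simp [ht, hs, hne]
    obtain ⟨s, hs⟩ := (eventually_all.2 ev).exists
    rw [← Finset.sum_congr rfl fun i _ => hs i, Finset.sum_sub_distrib, h, h, sub_zero]
  have h2 := Finset.sum_fiberwise_of_maps_to (s := Finset.univ)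
    (t := Finset.univ.image fun i => sSup (S i)) (g := fun i => sSup (S i))
    (fun i _ => Finset.mem_image_of_mem _ (Finset.mem_univ i))
    (fun i => if (S i).Nonempty then a i else 0)
  rw [← h2]
  refine Finset.sum_eq_zero fun t _ => ?_
  refine Eq.trans ?_ (key t)
  rw [Finset.sum_filter]
  refine Finset.sum_congr rfl fun i _ => ?_
  by_cases h1 : (S i).Nonempty <;> by_cases h3 : sSup (S i) = t <;> simp [h1, h3]

open Classical in
/-- A linear relation between indicators of compact convex sets is a relation between the
coefficients of the nonempty ones. -/
theorem sum_nonempty_eq_zero_of_pi {ι : Type*} [Fintype ι] (a : ι → ℝ) (m : ℕ)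
    (K : ι → Set (Fin m → ℝ)) (hc : ∀ i, IsCompact (K i)) (hK : ∀ i, Convex ℝ (K i))
    (h : ∀ x, ∑ i, (K i).indicator (fun _ => a i) x = 0) :
    ∑ i, (if (K i).Nonempty then a i else 0) = 0 := by
  induction m with
  | zero =>
    refine Eq.trans ?_ (h default)
    refine Finset.sum_congr rfl fun i _ => ?_
    rw [Set.indicator_apply]
    refine if_congr ⟨?_, fun hd => ⟨_, hd⟩⟩ rfl rfl
    rintro ⟨x, hx⟩
    rwa [Subsingleton.elim x default] at hx
  | succ m ih =>
    let tl : (Fin (m + 1) → ℝ) →ₗ[ℝ] (Fin m → ℝ) := LinearMap.funLeft ℝ ℝ Fin.succ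
    have htl : Continuous tl := by
      refine continuous_pi fun i => ?_
      exact continuous_apply (Fin.succ i)
    let hd : (Fin (m + 1) → ℝ) →ₗ[ℝ] ℝ := LinearMap.proj 0
    have hhd : Continuous hd := continuous_apply 0
    -- Project along the first coordinate. A point `y` lies in the projection of `K i` iff the fibre
    -- over `y` is nonempty, and the fibres are compact intervals, so the one-dimensional case gives
    -- the relation between the projections.
    have hih := ih (fun i => tl '' K i) (fun i => (hc i).image htl)
      (fun i => (hK i).linear_image tl) ?_
    · simpa using hih
    intro y
    let S : ι → Set ℝ := fun i => hd '' (K i ∩ tl ⁻¹' {y})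
    have mem_S : ∀ i t, t ∈ S i ↔ (Fin.cons t y : Fin (m + 1) → ℝ) ∈ K i := by
      intro i t
      constructor
      · rintro ⟨x, ⟨hx, hxy⟩, rfl⟩
        have : (Fin.cons (hd x) y : Fin (m + 1) → ℝ) = x := by
          have hxy' : tl x = y := hxy
          rw [← hxy']
          exact Fin.cons_self_tail x
        rwa [this]
      · intro ht
        exact ⟨_, ⟨ht, by ext i; simp [tl, LinearMap.funLeft]⟩, by simp [hd]⟩
    have h1 := sum_nonempty_eq_zero_of_real a S
      (fun i => ((hc i).inter_right (isClosed_singleton.preimage htl)).image hhd)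
      (fun i => ((hK i).inter ((convex_singleton y).linear_preimage tl)).linear_image hd) ?_
    · rw [← h1]
      refine Finset.sum_congr rfl fun i _ => ?_
      rw [Set.indicator_apply]
      refine if_congr ?_ rfl rfl
      simp only [S, Set.image_nonempty]
      constructor
      · rintro ⟨x, hx, hxy⟩
        exact ⟨x, hx, hxy⟩
      · rintro ⟨x, hx, hxy⟩
        exact ⟨x, hx, hxy⟩
    · intro t
      rw [← h (Fin.cons t y)]
      refine Finset.sum_congr rfl fun i _ => ?_
      simp only [Set.indicator_apply, mem_S]

variable {d : ℕ}

open Classical in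
theorem sum_nonempty_eq_zero {ι : Type*} [Fintype ι] (a : ι → ℝ)
    (K : ι → Set (EuclideanSpace ℝ (Fin d))) (hc : ∀ i, IsCompact (K i))
    (hK : ∀ i, Convex ℝ (K i)) (h : ∀ x, ∑ i, (K i).indicator (fun _ => a i) x = 0) :
    ∑ i, (if (K i).Nonempty then a i else 0) = 0 := by
  let e := EuclideanSpace.equiv (Fin d) ℝ
  have := sum_nonempty_eq_zero_of_pi a d (fun i => e '' K i)
    (fun i => (hc i).image e.continuous) (fun i => (hK i).linear_image e.toLinearMap) ?_
  · simpa using this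
  · intro x
    rw [← h (e.symm x)]
    refine Finset.sum_congr rfl fun i _ => ?_
    simp only [Set.indicator_apply]
    refine if_congr ?_ rfl rfl
    constructor
    · rintro ⟨y, hy, rfl⟩
      simpa using hy
    · intro hx
      exact ⟨_, hx, by simp⟩

/-! ### Intrinsic volumes respect linear relations -/

-- A point `x` lies in the `ε`-parallel set of `K i` iff `K i` meets the closed ball about `x`. The
-- sets `K i ∩ closedBall x ε` satisfy the same relation, so `sum_nonempty_eq_zero` yields the
-- relation for the parallel sets pointwise, and it can be integrated.
open Classical in
theorem sum_volume_cthickening_eq_zero {ι : Type*} [Fintype ι] (a : ι → ℝ)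
    (K : ι → Set (EuclideanSpace ℝ (Fin d))) (hc : ∀ i, IsCompact (K i))
    (hK : ∀ i, Convex ℝ (K i)) (h : ∀ x, ∑ i, (K i).indicator (fun _ => a i) x = 0)
    {ε : ℝ} (hε : 0 ≤ ε) :
    ∑ i, a i * volume.real (Metric.cthickening ε (K i)) = 0 := by
  have hpt : ∀ x, ∑ i, (Metric.cthickening ε (K i)).indicator (fun _ => a i) x = 0 := by
    intro x
    have := sum_nonempty_eq_zero a (fun i => K i ∩ Metric.closedBall x ε)
      (fun i => (hc i).inter_right Metric.isClosed_closedBall)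
      (fun i => (hK i).inter (convex_closedBall x ε)) ?_
    · rw [← this]
      refine Finset.sum_congr rfl fun i _ => ?_
      rw [Set.indicator_apply]
      refine if_congr ?_ rfl rfl
      rw [(hc i).cthickening_eq_biUnion_closedBall hε]
      simp only [Set.mem_iUnion, Metric.mem_closedBall, exists_prop, Set.Nonempty,
        Set.mem_inter_iff, dist_comm]
    · intro y
      by_cases hy : y ∈ Metric.closedBall x ε
      · rw [← h y]
        refine Finset.sum_congr rfl fun i _ => ?_
        simp only [Set.indicator_apply, Set.mem_inter_iff, hy, and_true]
      · exact Finset.sum_eq_zero fun i _ => by simp [hy]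
  have hm : ∀ i, MeasurableSet (Metric.cthickening ε (K i)) := fun i =>
    Metric.isClosed_cthickening.measurableSet
  have hfin : ∀ i, volume (Metric.cthickening ε (K i)) ≠ ⊤ := fun i =>
    ((hc i).cthickening).measure_lt_top.ne
  have hint : ∀ i, Integrable ((Metric.cthickening ε (K i)).indicator fun _ => a i)
      (volume : Measure (EuclideanSpace ℝ (Fin d))) := fun i =>
    (integrable_indicator_iff (hm i)).2 (integrableOn_const (hfin i))
  calc ∑ i, a i * volume.real (Metric.cthickening ε (K i))
      = ∑ i, ∫ x, (Metric.cthickening ε (K i)).indicator (fun _ => a i) x := by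
        refine Finset.sum_congr rfl fun i _ => ?_
        rw [integral_indicator_const _ (hm i), smul_eq_mul, mul_comm]
    _ = ∫ x, ∑ i, (Metric.cthickening ε (K i)).indicator (fun _ => a i) x :=
        (integral_finsetSum _ fun i _ => hint i).symm
    _ = 0 := by simp [hpt]

theorem unitBallVolume_pos (m : ℕ) : 0 < unitBallVolume m :=
  ENNReal.toReal_pos (Metric.measure_closedBall_pos volume _ one_pos).ne'
    measure_closedBall_lt_top.ne

theorem eq_zero_of_steinerPolynomial_eq_zero (v : Fin (d + 1) → ℝ)
    (h : ∀ ε : ℝ, 0 ≤ ε →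
      ∑ k : Fin (d + 1), unitBallVolume (d - (k : ℕ)) * v k * ε ^ (d - (k : ℕ)) = 0) : v = 0 := by
  let P : Polynomial ℝ := ∑ k : Fin (d + 1),
    Polynomial.monomial (d - (k : ℕ)) (unitBallVolume (d - (k : ℕ)) * v k)
  have hP : P = 0 := by
    refine Polynomial.eq_zero_of_infinite_isRoot P
      (Set.Infinite.mono (s := Set.Ici 0) (fun ε hε => ?_) (Set.Ici_infinite 0))
    have := h ε hε
    simpa [P, Polynomial.IsRoot, Polynomial.eval_finsetSum] using this
  funext k
  -- The exponents `d - k` are distinct because `k ≤ d`, so each coefficient of `P` comes from a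
  -- single `k`.
  have hk : P.coeff (d - (k : ℕ)) = unitBallVolume (d - (k : ℕ)) * v k := by
    simp only [P, Polynomial.finsetSum_coeff, Polynomial.coeff_monomial]
    rw [Finset.sum_eq_single k]
    · simp
    · intro l _ hl
      rw [if_neg]
      intro he
      apply hl
      ext
      omega
    · simp
  rw [hP, Polynomial.coeff_zero] at hk
  exact (mul_eq_zero.1 hk.symm).resolve_left (unitBallVolume_pos _).ne'

/-- The graph of the linear extension of the intrinsic volumes to linear combinations of
indicators of compact convex sets. -/
def steinerSpan (d : ℕ) :
    Submodule ℝ ((EuclideanSpace ℝ (Fin d) → ℝ) × (Fin (d + 1) → ℝ)) :=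
  Submodule.span ℝ {q | ∃ K, IsCompact K ∧ Convex ℝ K ∧ SteinerFormula K q.2 ∧
    q.1 = K.indicator 1}

/-- This says that `steinerSpan` really is the graph of a function: the Steiner polynomial with
coefficients `w` is the combination of parallel volumes, which vanishes for every `ε ≥ 0`. -/
theorem eq_zero_of_mem_steinerSpan {w : Fin (d + 1) → ℝ} (h : (0, w) ∈ steinerSpan d) :
    w = 0 := by
  obtain ⟨n, a, g, hg⟩ := (Submodule.mem_span_set').1 h
  choose K hc hK hS hi using fun i => (g i).2
  have h1 : ∀ x, ∑ i, (K i).indicator (fun _ => a i) x = 0 := by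
    intro x
    have := congrFun (congrArg Prod.fst hg) x
    simp only [Prod.fst_sum, Prod.smul_fst, hi, Finset.sum_apply, Pi.smul_apply, smul_eq_mul,
      Pi.zero_apply] at this
    rw [← this]
    refine Finset.sum_congr rfl fun i _ => ?_
    by_cases hx : x ∈ K i <;> simp [hx]
  have hw : w = ∑ i, a i • (g i).1.2 := by
    simpa [Prod.snd_sum] using (congrArg Prod.snd hg).symm
  refine eq_zero_of_steinerPolynomial_eq_zero w fun ε hε => ?_
  have h2 := sum_volume_cthickening_eq_zero a K hc hK h1 hε
  simp only [hS _ ε hε, Finset.mul_sum] at h2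
  rw [Finset.sum_comm] at h2
  rw [← h2]
  refine Finset.sum_congr rfl fun k _ => ?_
  rw [hw]
  simp only [Finset.sum_apply, Pi.smul_apply, smul_eq_mul, Finset.mul_sum, Finset.sum_mul]
  refine Finset.sum_congr rfl fun i _ => ?_
  ring

theorem HasIntrinsicVolumes.mem_steinerSpan {K : Set (EuclideanSpace ℝ (Fin d))}
    {v : Fin (d + 1) → ℝ} (h : HasIntrinsicVolumes K v) :
    (K.indicator (1 : EuclideanSpace ℝ (Fin d) → ℝ), v) ∈ steinerSpan d := by
  induction h with
  | convex hc hK hv => exact Submodule.subset_span ⟨_, hc, hK, hv, rfl⟩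
  | @union K L v w u _ _ _ h1 h2 h3 =>
    have := Submodule.sub_mem _ (Submodule.add_mem _ h1 h2) h3
    convert this using 1
    refine Prod.ext ?_ rfl
    funext x
    by_cases hx : x ∈ K <;> by_cases hy : x ∈ L <;> simp [hx, hy]

/-- `K` is a compact polyconvex set all of whose convex pieces satisfy the Steiner formula. -/
def IsPolyconvex (K : Set (EuclideanSpace ℝ (Fin d))) : Prop := ∃ v, HasIntrinsicVolumes K v

theorem IsPolyconvex.mem_steinerSpan {K : Set (EuclideanSpace ℝ (Fin d))} (h : IsPolyconvex K) :
    (K.indicator (1 : EuclideanSpace ℝ (Fin d) → ℝ), fun k => intrinsicVolume k K) ∈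
      steinerSpan d := by
  have : (fun k => intrinsicVolume k K) = h.choose := by
    funext k
    exact dif_pos h
  rw [this]
  exact h.choose_spec.mem_steinerSpan

/-- Independence of the choice: `v` and the chosen vector belong to the same indicator, so their
difference is paired with `0` in `steinerSpan`. -/
theorem HasIntrinsicVolumes.intrinsicVolume_eq {K : Set (EuclideanSpace ℝ (Fin d))}
    {v : Fin (d + 1) → ℝ} (h : HasIntrinsicVolumes K v) (k : Fin (d + 1)) :
    intrinsicVolume k K = v k := by
  have h1 := Submodule.sub_mem _ (IsPolyconvex.mem_steinerSpan ⟨v, h⟩) h.mem_steinerSpan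
  rw [Prod.mk_sub_mk, sub_self] at h1
  exact sub_eq_zero.1 (congrFun (eq_zero_of_mem_steinerSpan h1) k)

theorem sum_intrinsicVolume_eq_zero {ι : Type*} (s : Finset ι) (a : ι → ℝ)
    (A : ι → Set (EuclideanSpace ℝ (Fin d))) (hA : ∀ i ∈ s, IsPolyconvex (A i))
    (h : ∀ x, ∑ i ∈ s, a i * (A i).indicator 1 x = 0) (k : Fin (d + 1)) :
    ∑ i ∈ s, a i * intrinsicVolume k (A i) = 0 := by
  have h1 := Submodule.sum_mem _ fun i (hi : i ∈ s) =>
    Submodule.smul_mem _ (a i) (hA i hi).mem_steinerSpan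
  have h2 : (∑ i ∈ s, a i • ((A i).indicator (1 : EuclideanSpace ℝ (Fin d) → ℝ),
      fun k => intrinsicVolume k (A i))) =
      (0, fun k => ∑ i ∈ s, a i * intrinsicVolume k (A i)) := by
    refine Prod.ext ?_ ?_
    · funext x
      simpa [Prod.fst_sum] using h x
    · funext k
      simp [Prod.snd_sum]
  rw [h2] at h1
  exact congrFun (eq_zero_of_mem_steinerSpan h1) k

/-- Additivity. -/
theorem intrinsicVolume_union {K L : Set (EuclideanSpace ℝ (Fin d))} (hK : IsPolyconvex K)
    (hL : IsPolyconvex L) (hKL : IsPolyconvex (K ∩ L)) (k : Fin (d + 1)) :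
    intrinsicVolume k (K ∪ L) =
      intrinsicVolume k K + intrinsicVolume k L - intrinsicVolume k (K ∩ L) := by
  obtain ⟨v, hv⟩ := hK
  obtain ⟨w, hw⟩ := hL
  obtain ⟨u, hu⟩ := hKL
  rw [(HasIntrinsicVolumes.union hv hw hu).intrinsicVolume_eq, hv.intrinsicVolume_eq,
    hw.intrinsicVolume_eq, hu.intrinsicVolume_eq]
  rfl

/-- The inclusion-exclusion principle for intrinsic volumes. -/
theorem intrinsicVolume_biUnion {ι : Type*} [DecidableEq ι] (s : Finset ι)
    (A : ι → Set (EuclideanSpace ℝ (Fin d)))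
    (hU : IsPolyconvex (⋃ i ∈ s, A i))
    (hA : ∀ t : Finset ι, t.Nonempty → IsPolyconvex (⋂ i ∈ t, A i)) (k : Fin (d + 1)) :
    intrinsicVolume k (⋃ i ∈ s, A i) =
      ∑ t ∈ s.powerset with t.Nonempty,
        (-1 : ℝ) ^ (t.card - 1) * intrinsicVolume k (⋂ i ∈ t, A i) := by
  classical
  -- The index `none` carries the union with coefficient `-1`, and `some t` the intersection over
  -- `t`.
  have h := sum_intrinsicVolume_eq_zero (insert none ((s.powerset.filter (·.Nonempty)).map
      Function.Embedding.some))
    (fun o => o.elim (-1) fun t => (-1 : ℝ) ^ (t.card - 1))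
    (fun o => o.elim (⋃ i ∈ s, A i) fun t => ⋂ i ∈ t, A i) ?_ ?_ k
  · rw [Finset.sum_insert (by simp), Finset.sum_map] at h
    simp only [Option.elim_none, Function.Embedding.some_apply, Option.elim_some] at h
    linarith
  · intro o ho
    rcases o with _ | t
    · exact hU
    · simp only [Finset.mem_insert, Finset.mem_map, reduceCtorEq, false_or,
        Function.Embedding.some_apply, Option.some.injEq, exists_eq_right,
        Finset.mem_filter] at ho
      exact hA t ho.2
  · intro x
    rw [Finset.sum_insert (by simp), Finset.sum_map]
    simp only [Option.elim_none, Function.Embedding.some_apply, Option.elim_some]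
    have hx := Finset.indicator_biUnion_eq_sum_powerset s A
      (1 : EuclideanSpace ℝ (Fin d) → ℝ) x
    rw [hx, neg_one_mul, neg_add_eq_zero]
    refine Finset.sum_congr rfl fun t ht => ?_
    obtain ⟨m, hm⟩ : ∃ m, t.card = m + 1 :=
      Nat.exists_eq_succ_of_ne_zero (Finset.card_pos.2 (Finset.mem_filter.1 ht).2).ne'
    simp [hm, pow_succ]

end

section

/-! ### The Steiner formula for boxes -/

theorem volume_real_sum_sq_le (ι : Type*) [Fintype ι] {ε : ℝ} (hε : 0 ≤ ε) :
    volume.real {z : ι → ℝ | ∑ i, z i ^ 2 ≤ ε ^ 2} =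
      unitBallVolume (Fintype.card ι) * ε ^ Fintype.card ι := by
  have h1 : (WithLp.toLp 2) ⁻¹' (Metric.closedBall (0 : EuclideanSpace ℝ ι) ε) =
      {z : ι → ℝ | ∑ i, z i ^ 2 ≤ ε ^ 2} := by
    ext z
    simp only [Set.mem_preimage, mem_closedBall_zero_iff, EuclideanSpace.norm_eq, Set.mem_ofPred_eq,
      Real.norm_eq_abs, sq_abs]
    rw [Real.sqrt_le_left hε]
  have h2 : volume.real {z : ι → ℝ | ∑ i, z i ^ 2 ≤ ε ^ 2} =
      volume.real (Metric.closedBall (0 : EuclideanSpace ℝ ι) ε) := by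
    rw [← h1, Measure.real, (PiLp.volume_preserving_toLp ι).measure_preimage
      Metric.isClosed_closedBall.measurableSet.nullMeasurableSet, Measure.real]
  let f : EuclideanSpace ℝ ι ≃ₗᵢ[ℝ] EuclideanSpace ℝ (Fin (Fintype.card ι)) :=
    LinearIsometryEquiv.piLpCongrLeft 2 ℝ ℝ (Fintype.equivFin ι)
  have h3 : f ⁻¹' (Metric.closedBall 0 ε) = Metric.closedBall (0 : EuclideanSpace ℝ ι) ε := by
    ext z
    simp
  rw [h2, ← h3, Measure.real, f.measurePreserving.measure_preimage
      Metric.isClosed_closedBall.measurableSet.nullMeasurableSet,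
      Measure.addHaar_closedBall' _ _ hε, ENNReal.toReal_mul, ENNReal.toReal_ofReal (by positivity),
      finrank_euclideanSpace_fin, mul_comm, unitBallVolume, Measure.real]

/-- The signed distance to the interval `[a, b]`. -/
def residual (a b x : ℝ) : ℝ := x - max a (min b x)

theorem residual_of_lt {a b x : ℝ} (hab : a ≤ b) (h : x < a) : residual a b x = x - a := by
  rw [residual, min_eq_right (by linarith), max_eq_left h.le]

theorem residual_of_gt {a b x : ℝ} (hab : a ≤ b) (h : b < x) : residual a b x = x - b := by
  rw [residual, min_eq_left h.le, max_eq_right hab]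

theorem residual_of_mem {a b x : ℝ} (h : x ∈ Set.Icc a b) : residual a b x = 0 := by
  rw [residual, min_eq_right h.2, max_eq_right h.1, sub_self]

theorem continuous_residual (a b : ℝ) : Continuous (residual a b) := by
  unfold residual
  fun_prop

theorem residual_sq_le {a b x y : ℝ} (hab : a ≤ b) (hy : y ∈ Set.Icc a b) :
    residual a b x ^ 2 ≤ (x - y) ^ 2 := by
  by_cases h : x ∈ Set.Icc a b
  · rw [residual_of_mem h]
    nlinarith [sq_nonneg (x - y)]
  · rcases lt_or_ge x a with hx | hx
    · rw [residual_of_lt hab hx]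
      nlinarith [hy.1]
    · have hx' : b < x := not_le.1 fun h' => h ⟨hx, h'⟩
      rw [residual_of_gt hab hx']
      nlinarith [hy.2]

theorem measurePreserving_residual {a b : ℝ} (hab : a ≤ b) :
    MeasurePreserving (residual a b) (volume.restrict (Set.Icc a b)ᶜ) volume := by
  refine ⟨(continuous_residual a b).measurable, ?_⟩
  ext s hs
  rw [Measure.map_apply (continuous_residual a b).measurable hs,
    Measure.restrict_apply ((continuous_residual a b).measurable hs)]
  -- On either side of `[a, b]` the residual is a translation. The two images are the open
  -- half-lines, which cover `ℝ` up to the null set `{0}`.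
  have h1 : residual a b ⁻¹' s ∩ (Set.Icc a b)ᶜ =
      ((fun x => x - a) ⁻¹' (s ∩ Set.Iio 0)) ∪ ((fun x => x - b) ⁻¹' (s ∩ Set.Ioi 0)) := by
    ext x
    simp only [Set.mem_inter_iff, Set.mem_preimage, Set.mem_compl_iff, Set.mem_union,
      Set.mem_Iio, Set.mem_Ioi, sub_neg, sub_pos]
    constructor
    · rintro ⟨hx, hx'⟩
      rcases lt_or_ge x a with h | h
      · exact Or.inl ⟨residual_of_lt hab h ▸ hx, h⟩
      · have h' : b < x := not_le.1 fun h' => hx' ⟨h, h'⟩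
        exact Or.inr ⟨residual_of_gt hab h' ▸ hx, h'⟩
    · rintro (⟨hx, h⟩ | ⟨hx, h⟩)
      · exact ⟨(residual_of_lt hab h).symm ▸ hx, fun h' => absurd h'.1 (not_le.2 h)⟩
      · exact ⟨(residual_of_gt hab h).symm ▸ hx, fun h' => absurd h'.2 (not_le.2 h)⟩
  have hm : ∀ c : ℝ, Measurable fun x : ℝ => x - c := fun c => measurable_id.sub_const c
  have hv : ∀ (c : ℝ) (u : Set ℝ), volume ((fun x => x - c) ⁻¹' u) = volume u := fun c u => by
    simpa only [sub_eq_add_neg] using measure_preimage_add_right volume (-c) u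
  rw [h1, measure_union _ (hm b (hs.inter measurableSet_Ioi)), hv, hv,
    ← measure_union _ (hs.inter measurableSet_Ioi), ← Set.inter_union_distrib_left,
    Set.Iio_union_Ioi, measure_inter_conull]
  · simp
  · rw [Set.disjoint_left]
    intro x hx hx'
    have h1 : x < 0 := hx.2
    have h2 : 0 < x := hx'.2
    linarith
  · rw [Set.disjoint_left]
    intro x hx hx'
    have h1 : x - a < 0 := hx.2
    have h2 : 0 < x - b := hx'.2
    linarith

variable {d : ℕ}

/-- The axis-parallel box with lower corner `a` and upper corner `b`. -/
def box (a b : Fin d → ℝ) : Set (EuclideanSpace ℝ (Fin d)) := {x | ∀ i, x i ∈ Set.Icc (a i) (b i)}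

theorem box_eq_preimage (a b : Fin d → ℝ) :
    box a b = (EuclideanSpace.equiv (Fin d) ℝ).toHomeomorph ⁻¹'
      Set.pi Set.univ fun i => Set.Icc (a i) (b i) := by
  ext x
  simp only [box, Set.mem_preimage, Set.mem_pi, Set.mem_univ, true_imp_iff]
  rfl

theorem isCompact_box (a b : Fin d → ℝ) : IsCompact (box a b) := by
  rw [box_eq_preimage]
  exact (Homeomorph.isCompact_preimage _).2 (isCompact_univ_pi fun i => isCompact_Icc)

theorem convex_box (a b : Fin d → ℝ) : Convex ℝ (box a b) := by
  intro x hx y hy s t hs ht hst i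
  exact convex_Icc (a i) (b i) (hx i) (hy i) hs ht hst

theorem box_inter_box (a b a' b' : Fin d → ℝ) :
    box a b ∩ box a' b' = box (a ⊔ a') (b ⊓ b') := by
  ext x
  simp only [box, Set.mem_inter_iff, Set.mem_ofPred_eq, Set.mem_Icc, Pi.sup_apply, Pi.inf_apply,
    sup_le_iff, le_inf_iff, ← forall_and]
  exact forall_congr' fun i => by tauto

/-- Clamping every coordinate gives a nearest point of the box, at distance the Euclidean norm of
the residuals. -/
theorem mem_cthickening_box {a b : Fin d → ℝ} (hab : a ≤ b) {ε : ℝ} (hε : 0 ≤ ε)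
    (x : EuclideanSpace ℝ (Fin d)) :
    x ∈ Metric.cthickening ε (box a b) ↔ ∑ i, residual (a i) (b i) (x i) ^ 2 ≤ ε ^ 2 := by
  rw [(isCompact_box a b).cthickening_eq_biUnion_closedBall hε]
  simp only [Set.mem_iUnion, Metric.mem_closedBall, exists_prop, EuclideanSpace.dist_eq,
    Real.dist_eq, sq_abs, Real.sqrt_le_left hε]
  constructor
  · rintro ⟨y, hy, hxy⟩
    exact (Finset.sum_le_sum fun i _ => residual_sq_le (hab i) (hy i)).trans hxy
  · intro h
    refine ⟨WithLp.toLp 2 fun i => max (a i) (min (b i) (x i)), fun i => ?_, h⟩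
    exact ⟨le_max_left _ _, max_le (hab i) (min_le_left _ _)⟩

/-- The coordinates inside their intervals contribute the side lengths. On the others the residual
map carries the complements of the intervals to the whole line preserving measure, which leaves the
volume of a ball of radius `ε`. -/
theorem volume_real_residual_piece {a b : Fin d → ℝ} (hab : a ≤ b) {ε : ℝ} (hε : 0 ≤ ε)
    (p : Fin d → Prop) [DecidablePred p] :
    volume.real {x : Fin d → ℝ | (∀ i, x i ∈ Set.Icc (a i) (b i) ↔ p i) ∧
      ∑ i, residual (a i) (b i) (x i) ^ 2 ≤ ε ^ 2} =
      (∏ i : {i // p i}, (b i - a i)) *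
        (unitBallVolume (Fintype.card {i // ¬ p i}) * ε ^ (Fintype.card {i // ¬ p i})) := by
  let B : Set ({i // ¬ p i} → ℝ) :=
    {y | ∑ i : {i // ¬ p i}, residual (a i) (b i) (y i) ^ 2 ≤ ε ^ 2}
  have hBm : MeasurableSet B := by
    refine (isClosed_le (continuous_finsetSum _ fun i _ => ?_) continuous_const).measurableSet
    exact ((continuous_residual _ _).comp (continuous_apply i)).pow 2
  have hset : {x : Fin d → ℝ | (∀ i, x i ∈ Set.Icc (a i) (b i) ↔ p i) ∧
      ∑ i, residual (a i) (b i) (x i) ^ 2 ≤ ε ^ 2} =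
      MeasurableEquiv.piEquivPiSubtypeProd (fun _ => ℝ) p ⁻¹'
        ((Set.pi Set.univ fun i : {i // p i} => Set.Icc (a i) (b i)) ×ˢ
          (B ∩ Set.pi Set.univ fun i : {i // ¬ p i} => (Set.Icc (a i) (b i))ᶜ)) := by
    ext x
    have hsum : (∀ i, p i → x i ∈ Set.Icc (a i) (b i)) →
        ∑ i, residual (a i) (b i) (x i) ^ 2 =
          ∑ i : {i // ¬ p i}, residual (a i) (b i) (x i) ^ 2 := by
      intro h
      rw [← Fintype.sum_subtype_add_sum_subtype p, Finset.sum_eq_zero, zero_add]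
      intro i _
      rw [residual_of_mem (h i i.2)]
      simp
    have hB : MeasurableEquiv.piEquivPiSubtypeProd (fun _ => ℝ) p x ∈
        ((Set.pi Set.univ fun i : {i // p i} => Set.Icc (a i) (b i)) ×ˢ
          (B ∩ Set.pi Set.univ fun i : {i // ¬ p i} => (Set.Icc (a i) (b i))ᶜ)) ↔
        (∀ i, p i → x i ∈ Set.Icc (a i) (b i)) ∧
        (∑ i : {i // ¬ p i}, residual (a i) (b i) (x i) ^ 2 ≤ ε ^ 2 ∧
          ∀ i, ¬ p i → x i ∉ Set.Icc (a i) (b i)) := by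
      rw [Set.mem_prod, Set.mem_inter_iff, Set.mem_univ_pi, Set.mem_univ_pi, Subtype.forall,
        Subtype.forall]
      rfl
    rw [Set.mem_preimage, hB]
    constructor
    · rintro ⟨h1, h2⟩
      have h3 : ∀ i, p i → x i ∈ Set.Icc (a i) (b i) := fun i hi => (h1 i).2 hi
      exact ⟨h3, (hsum h3) ▸ h2, fun i hi h => hi ((h1 i).1 h)⟩
    · rintro ⟨h1, h2, h3⟩
      exact ⟨fun i => ⟨fun h => by_contra fun hi => h3 i hi h, h1 i⟩, (hsum h1).symm ▸ h2⟩
  have hB : volume (B ∩ Set.pi Set.univ fun i : {i // ¬ p i} => (Set.Icc (a i) (b i))ᶜ) =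
      volume {z : {i // ¬ p i} → ℝ | ∑ i, z i ^ 2 ≤ ε ^ 2} := by
    have hmp := measurePreserving_pi
      (fun i : {i // ¬ p i} => (volume : Measure ℝ).restrict (Set.Icc (a i) (b i))ᶜ)
      (fun _ => volume) (fun i => measurePreserving_residual (hab i))
    have hm : MeasurableSet {z : {i // ¬ p i} → ℝ | ∑ i, z i ^ 2 ≤ ε ^ 2} :=
      (isClosed_le (continuous_finsetSum _ fun i _ => (continuous_apply i).pow 2)
        continuous_const).measurableSet
    rw [← Measure.restrict_apply hBm, volume_pi, Measure.restrict_pi_pi,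
      ← hmp.measure_preimage hm.nullMeasurableSet]
    rfl
  have hpre := (volume_preserving_piEquivPiSubtypeProd (fun _ : Fin d => ℝ) p).measure_preimage_equiv
      ((Set.pi Set.univ fun i : {i // p i} => Set.Icc (a i) (b i)) ×ˢ
          (B ∩ Set.pi Set.univ fun i : {i // ¬ p i} => (Set.Icc (a i) (b i))ᶜ))
  have h1 := volume_real_sum_sq_le {i // ¬ p i} hε
  rw [Measure.real] at h1
  rw [hset, Measure.real, hpre, Measure.volume_eq_prod, Measure.prod_prod, hB, ENNReal.toReal_mul,
    volume_pi_pi, ENNReal.toReal_prod, h1]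
  congr 1
  refine Finset.prod_congr rfl fun i _ => ?_
  rw [Real.volume_Icc, ENNReal.toReal_ofReal (sub_nonneg.2 (hab i))]

/-- The intrinsic volumes of a nonempty box are the elementary symmetric functions of its side
lengths. -/
theorem steinerFormula_box {a b : Fin d → ℝ} (hab : a ≤ b) :
    SteinerFormula (box a b)
      (fun k => ∑ S : Finset (Fin d) with S.card = (k : ℕ), ∏ i ∈ S, (b i - a i)) := by
  intro ε hε
  -- The parallel set is cut according to the set `S` of coordinates that lie in their intervals.
  -- Pieces with `|S| = k` contribute to the term of `ε^(d-k)`.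
  let A : Finset (Fin d) → Set (Fin d → ℝ) := fun S =>
    {x : Fin d → ℝ | (∀ i, x i ∈ Set.Icc (a i) (b i) ↔ i ∈ S) ∧
      ∑ i, residual (a i) (b i) (x i) ^ 2 ≤ ε ^ 2}
  have hU : (WithLp.toLp 2) ⁻¹' (Metric.cthickening ε (box a b)) =
      ⋃ S ∈ (Finset.univ : Finset (Finset (Fin d))), A S := by
    classical
    ext x
    simp only [Set.mem_preimage, mem_cthickening_box hab hε, Set.mem_iUnion, Finset.mem_univ,
      exists_prop, true_and, A, Set.mem_ofPred_eq, exists_and_right]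
    refine ⟨fun h => ⟨⟨Finset.univ.filter fun i => x i ∈ Set.Icc (a i) (b i), by simp⟩, h⟩,
      fun h => h.2⟩
  have hdisj : Set.PairwiseDisjoint (↑(Finset.univ : Finset (Finset (Fin d)))) A := by
    intro S _ T _ hST
    refine Set.disjoint_left.2 fun x hx hx' => hST ?_
    ext i
    rw [← hx.1 i, hx'.1 i]
  have hm : ∀ S ∈ (Finset.univ : Finset (Finset (Fin d))), MeasurableSet (A S) := by
    intro S _
    refine MeasurableSet.inter (s₁ := {x : Fin d → ℝ | ∀ i, x i ∈ Set.Icc (a i) (b i) ↔ i ∈ S})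
      (s₂ := {x : Fin d → ℝ | ∑ i, residual (a i) (b i) (x i) ^ 2 ≤ ε ^ 2}) ?_ ?_
    · rw [Set.ofPred_forall]
      refine MeasurableSet.iInter fun i => ?_
      have hi : MeasurableSet {x : Fin d → ℝ | x i ∈ Set.Icc (a i) (b i)} :=
        measurable_pi_apply i measurableSet_Icc
      by_cases h : i ∈ S
      · simpa [h] using hi
      · simpa only [h, iff_false, ← Set.compl_ofPred] using hi.compl
    · refine (isClosed_le (continuous_finsetSum _ fun i _ => ?_) continuous_const).measurableSet
      exact ((continuous_residual _ _).comp (continuous_apply i)).pow 2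
  have hfin : volume (⋃ S ∈ (Finset.univ : Finset (Finset (Fin d))), A S) ≠ ⊤ := by
    rw [← hU, (PiLp.volume_preserving_toLp (Fin d)).measure_preimage
      Metric.isClosed_cthickening.measurableSet.nullMeasurableSet]
    exact (isCompact_box a b).cthickening.measure_lt_top.ne
  have h1 : volume.real (Metric.cthickening ε (box a b)) =
      volume.real (⋃ S ∈ (Finset.univ : Finset (Finset (Fin d))), A S) := by
    rw [← hU, Measure.real, Measure.real, (PiLp.volume_preserving_toLp (Fin d)).measure_preimage
      Metric.isClosed_cthickening.measurableSet.nullMeasurableSet]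
  rw [h1, measureReal_biUnion_finset hdisj hm fun S hS =>
    ne_top_of_le_ne_top hfin (measure_mono (Set.subset_biUnion_of_mem hS))]
  rw [← Finset.sum_fiberwise (g := fun S : Finset (Fin d) =>
    (⟨S.card, Nat.lt_succ_of_le (card_finset_fin_le S)⟩ : Fin (d + 1)))]
  refine Finset.sum_congr rfl fun k _ => ?_
  rw [Finset.mul_sum, Finset.sum_mul]
  refine Finset.sum_congr (Finset.filter_congr fun S _ => Fin.ext_iff) fun S hS => ?_
  have hk : S.card = (k : ℕ) := (Finset.mem_filter.1 hS).2
  rw [volume_real_residual_piece hab hε (· ∈ S), Fintype.card_subtype_compl, Fintype.card_fin,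
    Fintype.card_coe, hk, ← Finset.prod_subtype S (fun _ => Iff.rfl) fun i => b i - a i]
  ring

theorem hasIntrinsicVolumes_empty :
    HasIntrinsicVolumes (∅ : Set (EuclideanSpace ℝ (Fin d))) 0 :=
  .convex isCompact_empty convex_empty fun ε _ => by simp

theorem intrinsicVolume_empty (k : Fin (d + 1)) :
    intrinsicVolume k (∅ : Set (EuclideanSpace ℝ (Fin d))) = 0 :=
  hasIntrinsicVolumes_empty.intrinsicVolume_eq k

theorem isPolyconvex_empty : IsPolyconvex (∅ : Set (EuclideanSpace ℝ (Fin d))) :=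
  ⟨_, hasIntrinsicVolumes_empty⟩

theorem isPolyconvex_box (a b : Fin d → ℝ) : IsPolyconvex (box a b) := by
  by_cases hab : a ≤ b
  · exact ⟨_, .convex (isCompact_box a b) (convex_box a b) (steinerFormula_box hab)⟩
  · have : box a b = ∅ := by
      refine Set.eq_empty_of_forall_notMem fun x hx => hab fun i => ?_
      exact (hx i).1.trans (hx i).2
    rw [this]
    exact isPolyconvex_empty

theorem isPolyconvex_biUnion_box {ι : Type*} (s : Finset ι) (a b : ι → Fin d → ℝ) :
    IsPolyconvex (⋃ i ∈ s, box (a i) (b i)) := by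
  classical
  induction s using Finset.induction_on generalizing a b with
  | empty => simpa using isPolyconvex_empty
  | insert j s hj ih =>
    rw [Finset.set_biUnion_insert]
    obtain ⟨v, hv⟩ := isPolyconvex_box (a j) (b j)
    obtain ⟨w, hw⟩ := ih a b
    -- The overlap with the new box is again a union of boxes indexed by `s`, which is why the
    -- induction generalizes over the corners.
    obtain ⟨u, hu⟩ := ih (fun i => a j ⊔ a i) (fun i => b j ⊓ b i)
    refine ⟨_, .union hv hw (u := u) ?_⟩
    simpa only [Set.inter_iUnion₂, box_inter_box] using hu

/-! ### Homogeneity -/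

open scoped Pointwise

theorem steinerFormula_image {K : Set (EuclideanSpace ℝ (Fin d))} {v : Fin (d + 1) → ℝ}
    (h : SteinerFormula K v) {s : ℝ} (hs : 0 < s) (t : EuclideanSpace ℝ (Fin d)) :
    SteinerFormula ((fun x => s • x + t) '' K) (fun k => s ^ (k : ℕ) * v k) := by
  intro ε hε
  have himg : (fun x => s • x + t) '' K = (t + ·) '' (s • K) := by
    rw [← Set.image_smul, Set.image_image]
    simp only [add_comm]
  have h1 : Metric.cthickening ε ((fun x => s • x + t) '' K) =
      (t + ·) '' (s • Metric.cthickening (ε / s) K) := by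
    rw [himg]
    ext x
    rw [Set.image_add_left (t := s • Metric.cthickening (ε / s) K), Set.mem_preimage,
      Set.mem_smul_set_iff_inv_smul_mem₀ hs.ne']
    rw [Metric.mem_cthickening_iff, Metric.mem_cthickening_iff]
    have e1 : Metric.infEDist x ((t + ·) '' (s • K)) = Metric.infEDist (-t + x) (s • K) := by
      have := Metric.infEDist_image (isometry_add_left t) (x := -t + x) (t := s • K)
      simpa using this
    have e2 : Metric.infEDist (s • (s⁻¹ • (-t + x))) (s • K) =
        ‖s‖₊ • Metric.infEDist (s⁻¹ • (-t + x)) K := infEDist_smul₀ hs.ne' _ _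
    rw [smul_inv_smul₀ hs.ne'] at e2
    have hsn : ‖s‖₊ = s.toNNReal := by
      ext
      simp [hs.le]
    have e3 : ENNReal.ofReal ε = ENNReal.ofReal s * ENNReal.ofReal (ε / s) := by
      rw [← ENNReal.ofReal_mul hs.le, mul_div_cancel₀ _ hs.ne']
    rw [e1, e2, e3, hsn, ENNReal.smul_def, smul_eq_mul]
    exact ENNReal.mul_le_mul_iff_right (by simpa using hs) (by simp)
  have h2 : volume.real (Metric.cthickening ε ((fun x => s • x + t) '' K)) =
      s ^ d * volume.real (Metric.cthickening (ε / s) K) := by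
    rw [h1, Measure.real, Set.image_add_left, measure_preimage_add, Measure.addHaar_smul,
      ENNReal.toReal_mul, ENNReal.toReal_ofReal (abs_nonneg _), finrank_euclideanSpace_fin,
      abs_of_pos (pow_pos hs d), Measure.real]
  rw [h2, h _ (by positivity), Finset.mul_sum]
  refine Finset.sum_congr rfl fun k _ => ?_
  have hk : d = (k : ℕ) + (d - (k : ℕ)) := by omega
  have : s ^ d = s ^ (k : ℕ) * s ^ (d - (k : ℕ)) := by rw [← pow_add, ← hk]
  rw [this, div_pow]
  field_simp

theorem HasIntrinsicVolumes.image {K : Set (EuclideanSpace ℝ (Fin d))} {v : Fin (d + 1) → ℝ}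
    (h : HasIntrinsicVolumes K v) {s : ℝ} (hs : 0 < s) (t : EuclideanSpace ℝ (Fin d)) :
    HasIntrinsicVolumes ((fun x => s • x + t) '' K) (fun k => s ^ (k : ℕ) * v k) := by
  induction h with
  | convex hc hK hv =>
    refine .convex (hc.image (by fun_prop)) ?_ (steinerFormula_image hv hs t)
    have := (hK.smul s).translate t
    rwa [← Set.image_smul, Set.image_image, show (fun x => t + s • x) = fun x => s • x + t from
      funext fun x => add_comm _ _] at this
  | @union K L v w u _ _ _ h1 h2 h3 =>
    have hinj : Function.Injective fun x : EuclideanSpace ℝ (Fin d) => s • x + t := fun x y hxy =>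
      smul_right_injective _ hs.ne' (add_right_cancel hxy)
    rw [Set.image_inter hinj] at h3
    have := HasIntrinsicVolumes.union h1 h2 h3
    rw [← Set.image_union] at this
    convert this using 1
    funext k
    simp only [Pi.add_apply, Pi.sub_apply]
    ring

theorem intrinsicVolume_image {K : Set (EuclideanSpace ℝ (Fin d))} (hK : IsPolyconvex K)
    {s : ℝ} (hs : 0 < s) (t : EuclideanSpace ℝ (Fin d)) (k : Fin (d + 1)) :
    intrinsicVolume k ((fun x => s • x + t) '' K) = s ^ (k : ℕ) * intrinsicVolume k K := by
  obtain ⟨v, hv⟩ := hK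
  rw [(hv.image hs t).intrinsicVolume_eq, hv.intrinsicVolume_eq]

end

section

/-! ### Cells of the grid and unions of cells -/

variable {d : ℕ}

/-- The cell of the grid of mesh `s` with corners `s * (c i).1` and `s * (c i).2`. -/
def cell (s : ℝ) (c : Fin d → ℤ × ℤ) : Set (EuclideanSpace ℝ (Fin d)) :=
  box (fun i => s * ((c i).1 : ℝ)) (fun i => s * ((c i).2 : ℝ))

theorem image_box {s : ℝ} (hs : 0 < s) (t : EuclideanSpace ℝ (Fin d)) (a b : Fin d → ℝ) :
    (fun x => s • x + t) '' box a b = box (fun i => s * a i + t i) (fun i => s * b i + t i) := by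
  ext x
  constructor
  · rintro ⟨y, hy, rfl⟩ i
    have h1 := mul_le_mul_of_nonneg_left (hy i).1 hs.le
    have h2 := mul_le_mul_of_nonneg_left (hy i).2 hs.le
    exact ⟨by simpa using h1, by simpa using h2⟩
  · intro hx
    refine ⟨s⁻¹ • (x - t), fun i => ?_, by simp [hs.ne']⟩
    have h1 : s * a i ≤ x i - t i := by linarith [(hx i).1]
    have h2 : x i - t i ≤ s * b i := by linarith [(hx i).2]
    have h3 : (s⁻¹ • (x - t)) i = s⁻¹ * (x i - t i) := by simp
    rw [h3]
    exact ⟨(le_inv_mul_iff₀ hs).2 h1, (inv_mul_le_iff₀ hs).2 h2⟩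

theorem image_cell_one {s : ℝ} (hs : 0 < s) (g : Fin d → ℤ × ℤ) (l : Fin d → ℤ) :
    (fun x => s • x + WithLp.toLp 2 fun i => s * (l i : ℝ)) '' cell 1 g =
      cell s fun i => ((g i).1 + l i, (g i).2 + l i) := by
  rw [cell, image_box hs, cell]
  congr 1 <;> funext i <;> push_cast <;> ring

/-- The indices of the faces of the unit cube. -/
def unitFaces (d : ℕ) : Finset (Fin d → ℤ × ℤ) :=
  Fintype.piFinset fun _ => Finset.Icc 0 1 ×ˢ Finset.Icc 0 1

open Classical in
theorem cell_inter_biUnion_cell {s : ℝ} (hs : 0 < s) (c : Fin d → ℤ × ℤ)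
    (hc : ∀ i, (c i).2 ≤ (c i).1 + 1) (u : Finset (Fin d → ℤ × ℤ)) :
    ∃ 𝒢 ⊆ unitFaces d, cell s c ∩ ⋃ c' ∈ u, cell s c' =
      (fun x => s • x + WithLp.toLp 2 fun i => s * ((c i).1 : ℝ)) '' ⋃ g ∈ 𝒢, cell 1 g := by
  refine ⟨(unitFaces d).filter fun g =>
    cell s (fun i => ((g i).1 + (c i).1, (g i).2 + (c i).1)) ⊆ cell s c ∩ ⋃ c' ∈ u, cell s c',
    Finset.filter_subset _ _, ?_⟩
  simp only [Set.image_iUnion, image_cell_one hs]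
  refine Set.Subset.antisymm ?_ ?_
  · rintro x ⟨hx, hxu⟩
    obtain ⟨c', hc', hx'⟩ := Set.mem_iUnion₂.1 hxu
    have hlo : ∀ i, s * ((max (c i).1 (c' i).1 : ℤ) : ℝ) ≤ x i := fun i => by
      rcases max_choice (c i).1 (c' i).1 with h | h <;> rw [h]
      exacts [(hx i).1, (hx' i).1]
    have hhi : ∀ i, x i ≤ s * ((min (c i).2 (c' i).2 : ℤ) : ℝ) := fun i => by
      rcases min_choice (c i).2 (c' i).2 with h | h <;> rw [h]
      exacts [(hx i).2, (hx' i).2]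
    -- The face is `cell s c ∩ cell s c'` relative to the lower corner of `c`. It contains `x`, so
    -- its corners are ordered, and `hc` confines them to `{0, 1}`.
    refine Set.mem_iUnion₂.2 ⟨fun i => (max (c i).1 (c' i).1 - (c i).1,
      min (c i).2 (c' i).2 - (c i).1), ?_, ?_⟩
    · rw [Finset.mem_filter, unitFaces, Fintype.mem_piFinset]
      refine ⟨fun i => ?_, ?_⟩
      · have h1 : max (c i).1 (c' i).1 ≤ min (c i).2 (c' i).2 := by
          exact_mod_cast le_of_mul_le_mul_left ((hlo i).trans (hhi i)) hs
        have := hc i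
        simp only [Finset.mem_product, Finset.mem_Icc]
        omega
      · intro y hy
        have hy' : ∀ i, s * ((max (c i).1 (c' i).1 : ℤ) : ℝ) ≤ y i ∧
            y i ≤ s * ((min (c i).2 (c' i).2 : ℤ) : ℝ) := fun i => by
          have := hy i
          simp only [sub_add_cancel] at this
          exact this
        have hle : ∀ {m n : ℤ}, m ≤ n → s * (m : ℝ) ≤ s * (n : ℝ) := fun h =>
          mul_le_mul_of_nonneg_left (by exact_mod_cast h) hs.le
        refine ⟨fun i => ?_, Set.mem_iUnion₂.2 ⟨c', hc', fun i => ?_⟩⟩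
        · exact ⟨(hle (le_max_left _ _)).trans (hy' i).1, (hy' i).2.trans (hle (min_le_left _ _))⟩
        · exact ⟨(hle (le_max_right _ _)).trans (hy' i).1,
            (hy' i).2.trans (hle (min_le_right _ _))⟩
    · intro i
      have h1 := hlo i
      have h2 := hhi i
      simp only [sub_add_cancel]
      exact ⟨h1, h2⟩
  · refine Set.iUnion₂_subset fun g hg => ?_
    exact (Finset.mem_filter.1 hg).2

theorem isPolyconvex_biUnion_cell (s : ℝ) (u : Finset (Fin d → ℤ × ℤ)) :
    IsPolyconvex (⋃ c ∈ u, cell s c) := isPolyconvex_biUnion_box _ _ _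

/-- The intrinsic volumes of a union of cells are bounded by the number of cells. -/
theorem exists_abs_intrinsicVolume_biUnion_cell_le (d : ℕ) (k : Fin (d + 1)) :
    ∃ C : ℝ, 0 ≤ C ∧ ∀ s : ℝ, 0 < s → ∀ u : Finset (Fin d → ℤ × ℤ),
      (∀ c ∈ u, ∀ i, (c i).2 ≤ (c i).1 + 1) →
      |intrinsicVolume k (⋃ c ∈ u, cell s c)| ≤ C * u.card * s ^ (k : ℕ) := by
  classical
  -- A sum over the finitely many possible overlaps dominates each of them. The final factor `2`
  -- accounts for the new cell itself (the overlap with `{c}`) and for its overlap with the earlier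
  -- cells.
  let C₀ : ℝ := ∑ 𝒢 ∈ (unitFaces d).powerset, |intrinsicVolume k (⋃ g ∈ 𝒢, cell 1 g)|
  have hC₀ : ∀ s : ℝ, 0 < s → ∀ c : Fin d → ℤ × ℤ, (∀ i, (c i).2 ≤ (c i).1 + 1) →
      ∀ u : Finset (Fin d → ℤ × ℤ),
        |intrinsicVolume k (cell s c ∩ ⋃ c' ∈ u, cell s c')| ≤ C₀ * s ^ (k : ℕ) := by
    intro s hs c hc u
    obtain ⟨𝒢, h𝒢, heq⟩ := cell_inter_biUnion_cell hs c hc u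
    rw [heq, intrinsicVolume_image (isPolyconvex_biUnion_cell 1 𝒢) hs, abs_mul,
      abs_of_pos (pow_pos hs _), mul_comm]
    refine mul_le_mul_of_nonneg_right ?_ (pow_pos hs _).le
    exact Finset.single_le_sum (f := fun 𝒢 => |intrinsicVolume k (⋃ g ∈ 𝒢, cell 1 g)|)
      (fun _ _ => abs_nonneg _) (Finset.mem_powerset.2 h𝒢)
  have hC₀0 : 0 ≤ C₀ := Finset.sum_nonneg fun _ _ => abs_nonneg _
  refine ⟨2 * C₀, by positivity, fun s hs u => ?_⟩
  induction u using Finset.induction_on with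
  | empty => simp [intrinsicVolume_empty]
  | insert c u hcu ih =>
    intro h
    have hu := ih fun c' hc' => h c' (Finset.mem_insert_of_mem hc')
    have hc := h c (Finset.mem_insert_self c u)
    have h1 := hC₀ s hs c hc {c}
    have h2 := hC₀ s hs c hc u
    simp only [Finset.mem_singleton, Set.iUnion_iUnion_eq_left, Set.inter_self] at h1
    have hpoly : IsPolyconvex (cell s c ∩ ⋃ c' ∈ u, cell s c') := by
      simp only [Set.inter_iUnion₂, cell, box_inter_box]
      exact isPolyconvex_biUnion_box u _ _
    have hcell : IsPolyconvex (cell s c) := isPolyconvex_box _ _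
    rw [Finset.set_biUnion_insert, intrinsicVolume_union hcell
      (isPolyconvex_biUnion_cell s u) hpoly, Finset.card_insert_of_notMem hcu]
    push_cast
    rw [abs_le] at h1 h2 hu ⊢
    constructor <;> nlinarith

/-- A set in the unit cube is cubical of mesh `s` if it is a union of closed cells of the grid of
mesh `s`. -/
def IsCubical (s : ℝ) (X : Set (EuclideanSpace ℝ (Fin d))) : Prop :=
  X ⊆ unitCube d ∧ ∀ x ∈ X, cell s (fun i => (⌊x i / s⌋, ⌈x i / s⌉)) ⊆ X

theorem mem_cell_floor_ceil {s : ℝ} (hs : 0 < s) (x : EuclideanSpace ℝ (Fin d)) :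
    x ∈ cell s (fun i => (⌊x i / s⌋, ⌈x i / s⌉)) := fun _ =>
  ⟨(le_div_iff₀' hs).1 (Int.floor_le _), (div_le_iff₀' hs).1 (Int.le_ceil _)⟩

-- Rounding coordinates down and up gives the smallest cell containing a point. Surplus cells in
-- `P`, even those leaving the unit cube, are harmless because the filter discards them.
open Classical in
theorem IsCubical.eq_biUnion_cell {s : ℝ} (hs : 0 < s) {X : Set (EuclideanSpace ℝ (Fin d))}
    (hX : IsCubical s X) (P : Finset (Fin d → ℤ × ℤ))
    (hP : ∀ x ∈ X, (fun i => (⌊x i / s⌋, ⌈x i / s⌉)) ∈ P) :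
    X = ⋃ c ∈ P.filter fun c => cell s c ⊆ X, cell s c := by
  refine Set.Subset.antisymm (fun x hx => ?_) (Set.iUnion₂_subset fun c hc =>
    (Finset.mem_filter.1 hc).2)
  exact Set.mem_iUnion₂.2 ⟨_, Finset.mem_filter.2 ⟨hP x hx, hX.2 x hx⟩, mem_cell_floor_ceil hs x⟩

/-- The intervals of the grid `{0, …, N}`, degenerate or of length one. -/
def gridIntervals (N : ℕ) : Finset (ℤ × ℤ) :=
  (Finset.Icc 0 (N : ℤ)).image (fun m => (m, m)) ∪ (Finset.Icc 0 (N : ℤ)).image fun m => (m, m + 1)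

theorem card_gridIntervals_le (N : ℕ) : (gridIntervals N).card ≤ 2 * (N + 1) := by
  refine (Finset.card_union_le _ _).trans ?_
  have h : (Finset.Icc 0 (N : ℤ)).card = N + 1 := by simp
  have h1 := Finset.card_image_le (s := Finset.Icc 0 (N : ℤ)) (f := fun m => (m, m))
  have h2 := Finset.card_image_le (s := Finset.Icc 0 (N : ℤ)) (f := fun m => (m, m + 1))
  omega

theorem snd_le_of_mem_gridIntervals {N : ℕ} {q : ℤ × ℤ} (hq : q ∈ gridIntervals N) :
    q.2 ≤ q.1 + 1 := by
  simp only [gridIntervals, Finset.mem_union, Finset.mem_image] at hq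
  rcases hq with ⟨m, _, rfl⟩ | ⟨m, _, rfl⟩ <;> simp

theorem floor_ceil_mem_gridIntervals {N : ℕ} (hN : 0 < N) {x : ℝ} (hx : x ∈ Set.Icc (0 : ℝ) 1) :
    (⌊x / (1 / (N : ℝ))⌋, ⌈x / (1 / (N : ℝ))⌉) ∈ gridIntervals N := by
  have hN' : (0 : ℝ) < N := by exact_mod_cast hN
  have h1 : x / (1 / (N : ℝ)) = x * N := by field_simp
  rw [h1]
  have h0 : 0 ≤ ⌊x * N⌋ := Int.floor_nonneg.2 (mul_nonneg hx.1 hN'.le)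
  have h2 : ⌊x * N⌋ ≤ (N : ℤ) := by
    have h3 : (⌊x * N⌋ : ℝ) ≤ N := (Int.floor_le _).trans (by nlinarith [hx.2])
    exact_mod_cast h3
  simp only [gridIntervals, Finset.mem_union, Finset.mem_image, Finset.mem_Icc, Prod.mk.injEq]
  have h4 := Int.floor_le_ceil (x * N)
  have h5 := Int.ceil_le_floor_add_one (x * N)
  rcases h4.eq_or_lt with h | h
  · exact Or.inl ⟨_, ⟨h0, h2⟩, rfl, h⟩
  · exact Or.inr ⟨_, ⟨h0, h2⟩, rfl, by omega⟩

theorem IsCubical.isPolyconvex {N : ℕ} (hN : 0 < N) {X : Set (EuclideanSpace ℝ (Fin d))}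
    (hX : IsCubical (1 / (N : ℝ)) X) : IsPolyconvex X := by
  rw [hX.eq_biUnion_cell (by positivity) (Fintype.piFinset fun _ => gridIntervals N) fun x hx =>
    Fintype.mem_piFinset.2 fun i => floor_ceil_mem_gridIntervals hN (hX.1 hx i)]
  exact isPolyconvex_biUnion_cell _ _

/-- The intrinsic volumes of cubical sets contained in a hyperplane. -/
theorem exists_abs_intrinsicVolume_cubical_le (d : ℕ) (k : Fin (d + 1)) :
    ∃ C : ℝ, 0 ≤ C ∧ ∀ N : ℕ, 0 < N → ∀ X : Set (EuclideanSpace ℝ (Fin d)),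
      IsCubical (1 / (N : ℝ)) X → ∀ (i₀ : Fin d) (m : ℤ),
      (∀ x ∈ X, x i₀ = (m : ℝ) * (1 / (N : ℝ))) →
      |intrinsicVolume k X| ≤ C * (N : ℝ) ^ (d - 1) * (1 / (N : ℝ)) ^ (k : ℕ) := by
  classical
  obtain ⟨C, hC0, hC⟩ := exists_abs_intrinsicVolume_biUnion_cell_le d k
  -- The coordinate `i₀` allows only the degenerate interval `(m, m)`, and each of the other `d - 1`
  -- coordinates at most `2 (N + 1) ≤ 4 N` intervals.
  refine ⟨C * 4 ^ (d - 1), by positivity, fun N hN X hX i₀ m hm => ?_⟩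
  have hN' : (0 : ℝ) < N := by exact_mod_cast hN
  let P : Finset (Fin d → ℤ × ℤ) :=
    Fintype.piFinset fun i => if i = i₀ then {(m, m)} else gridIntervals N
  have hP : ∀ x ∈ X, (fun i => (⌊x i / (1 / (N : ℝ))⌋, ⌈x i / (1 / (N : ℝ))⌉)) ∈ P := by
    intro x hx
    refine Fintype.mem_piFinset.2 fun i => ?_
    split_ifs with h
    · rw [h, hm x hx, mul_div_cancel_right₀ _ (by positivity)]
      simp
    · exact floor_ceil_mem_gridIntervals hN (hX.1 hx i)
  have hP1 : ∀ c ∈ P, ∀ i, (c i).2 ≤ (c i).1 + 1 := by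
    intro c hc i
    have := Fintype.mem_piFinset.1 hc i
    split_ifs at this
    · rw [Finset.mem_singleton.1 this]
      simp
    · exact snd_le_of_mem_gridIntervals this
  have hcard : (P.card : ℝ) ≤ (4 * N) ^ (d - 1) := by
    have h1 : P.card ≤ (4 * N) ^ (d - 1) := by
      rw [Fintype.card_piFinset, ← Finset.mul_prod_erase _ _ (Finset.mem_univ i₀), if_pos rfl,
        Finset.card_singleton, one_mul]
      calc _ ≤ ∏ i ∈ Finset.univ.erase i₀, 4 * N := by
            refine Finset.prod_le_prod' fun i hi => ?_
            rw [if_neg (Finset.ne_of_mem_erase hi)]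
            exact (card_gridIntervals_le N).trans (by omega)
        _ = _ := by simp
    exact_mod_cast h1
  rw [hX.eq_biUnion_cell (by positivity) P hP]
  refine (hC _ (by positivity) _ fun c hc => hP1 c (Finset.filter_subset _ _ hc)).trans ?_
  refine mul_le_mul_of_nonneg_right ?_ (by positivity)
  rw [mul_assoc, ← mul_pow]
  refine mul_le_mul_of_nonneg_left (le_trans ?_ hcard) hC0
  exact_mod_cast Finset.card_filter_le _ _

theorem IsCubical.biUnion {ι : Type*} {s : ℝ} (u : Set ι) {A : ι → Set (EuclideanSpace ℝ (Fin d))}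
    (h : ∀ i ∈ u, IsCubical s (A i)) : IsCubical s (⋃ i ∈ u, A i) := by
  refine ⟨Set.iUnion₂_subset fun i hi => (h i hi).1, fun x hx => ?_⟩
  obtain ⟨i, hi, hxi⟩ := Set.mem_iUnion₂.1 hx
  exact ((h i hi).2 x hxi).trans (Set.subset_biUnion_of_mem (u := A) hi)

theorem IsCubical.biInter {ι : Type*} {s : ℝ} {u : Finset ι} (hu : u.Nonempty)
    {A : ι → Set (EuclideanSpace ℝ (Fin d))} (h : ∀ i ∈ u, IsCubical s (A i)) :
    IsCubical s (⋂ i ∈ u, A i) := by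
  refine ⟨?_, fun x hx => Set.subset_iInter₂ fun i hi => (h i hi).2 x (Set.mem_iInter₂.1 hx i hi)⟩
  obtain ⟨i, hi⟩ := hu
  exact (Set.biInter_subset_of_mem (s := u) (t := A) hi).trans (h i hi).1

/-! ### The cubes of the construction -/

variable {M : ℕ}

theorem unitCube_eq_box : unitCube d = box (fun _ => 0) fun _ => 1 := rfl

theorem subcubeMap_eq (j : Label d M) :
    subcubeMap j = fun x => (1 / (M : ℝ)) • x + WithLp.toLp 2 fun i => (j i : ℕ) / (M : ℝ) := by
  funext x
  ext i
  simp [subcubeMap]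
  ring

theorem exists_cube_eq_cell (hM : 0 < M) (σ : List (Label d M)) :
    ∃ a : Fin d → ℤ, cube σ = cell (1 / ((M ^ σ.length : ℕ) : ℝ)) fun i => (a i, a i + 1) := by
  have hM' : (0 : ℝ) < M := by exact_mod_cast hM
  induction σ with
  | nil => exact ⟨0, by simp [cube, unitCube_eq_box, cell]⟩
  | cons j σ ih =>
    obtain ⟨a, ha⟩ := ih
    refine ⟨fun i => a i + (j i : ℕ) * M ^ σ.length, ?_⟩
    rw [cube, ha, subcubeMap_eq, cell, image_box (by positivity), cell]
    congr 1 <;> funext i <;> push_cast [List.length_cons] <;> field_simp <;> ring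

theorem subcubeMap_mem_unitCube (hM : 0 < M) (j : Label d M) {x : EuclideanSpace ℝ (Fin d)}
    (hx : x ∈ unitCube d) (i : Fin d) :
    subcubeMap j x i ∈ Set.Icc ((j i : ℕ) / (M : ℝ)) (((j i : ℕ) + 1) / (M : ℝ)) := by
  have hM' : (0 : ℝ) < M := by exact_mod_cast hM
  have h := hx i
  simp only [subcubeMap]
  exact ⟨(div_le_div_iff_of_pos_right hM').2 (by linarith [h.1]),
    (div_le_div_iff_of_pos_right hM').2 (by linarith [h.2])⟩

theorem cube_subset_unitCube (hM : 0 < M) (σ : List (Label d M)) : cube σ ⊆ unitCube d := by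
  have hM' : (0 : ℝ) < M := by exact_mod_cast hM
  induction σ with
  | nil => exact subset_rfl
  | cons j σ ih =>
    rintro _ ⟨x, hx, rfl⟩ i
    have h := subcubeMap_mem_unitCube hM j (ih hx) i
    refine ⟨le_trans (by positivity) h.1, h.2.trans ((div_le_one hM').2 ?_)⟩
    exact_mod_cast (j i).2

theorem isCubical_cube (hM : 0 < M) (σ : List (Label d M)) :
    IsCubical (1 / ((M ^ σ.length : ℕ) : ℝ)) (cube σ) := by
  refine ⟨cube_subset_unitCube hM σ, fun x hx => ?_⟩
  obtain ⟨a, ha⟩ := exists_cube_eq_cell hM σ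
  have hs : 0 < 1 / ((M ^ σ.length : ℕ) : ℝ) := by positivity
  rw [ha] at hx ⊢
  intro y hy i
  have hle : ∀ {m n : ℤ}, m ≤ n → (1 / ((M ^ σ.length : ℕ) : ℝ)) * (m : ℝ) ≤
      (1 / ((M ^ σ.length : ℕ) : ℝ)) * (n : ℝ) := fun h =>
    mul_le_mul_of_nonneg_left (by exact_mod_cast h) hs.le
  exact ⟨(hle (Int.le_floor.2 ((le_div_iff₀' hs).2 (hx i).1))).trans (hy i).1,
    (hy i).2.trans (hle (Int.ceil_le.2 ((div_le_iff₀' hs).2 (hx i).2)))⟩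

theorem subcubeMap_injective (hM : 0 < M) (j : Label d M) : Function.Injective (subcubeMap j) := by
  have hM' : (M : ℝ) ≠ 0 := by exact_mod_cast hM.ne'
  intro x y h
  ext i
  have := congrArg (fun z : EuclideanSpace ℝ (Fin d) => z i) h
  simp only [subcubeMap] at this
  field_simp at this
  linarith

theorem continuous_subcubeMap (j : Label d M) : Continuous (subcubeMap j) := by
  rw [subcubeMap_eq]
  fun_prop

theorem unitCube_eq_iUnion (hM : 0 < M) (n : ℕ) :
    unitCube d = ⋃ σ ∈ {σ : List (Label d M) | σ.length = n}, cube σ := by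
  have hM' : (0 : ℝ) < M := by exact_mod_cast hM
  refine Set.Subset.antisymm ?_ (Set.iUnion₂_subset fun σ _ => cube_subset_unitCube hM σ)
  induction n with
  | zero => exact fun x hx => Set.mem_iUnion₂.2 ⟨[], rfl, hx⟩
  | succ n ih =>
    intro x hx
    -- The minimum matters only on the face `x i = 1`, which belongs to the last subcube.
    let j : Label d M := fun i => ⟨min ⌊x i * M⌋₊ (M - 1), by omega⟩
    let y : EuclideanSpace ℝ (Fin d) := WithLp.toLp 2 fun i => x i * M - (j i : ℕ)
    have hy : y ∈ unitCube d := by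
      intro i
      have h0 : 0 ≤ x i * M := mul_nonneg (hx i).1 hM'.le
      have h1 : x i * M ≤ M := by nlinarith [(hx i).2]
      have hc : ((M - 1 : ℕ) : ℝ) = M - 1 := by
        rw [Nat.cast_sub hM, Nat.cast_one]
      change x i * M - ((min ⌊x i * M⌋₊ (M - 1) : ℕ) : ℝ) ∈ Set.Icc (0 : ℝ) 1
      rcases le_total ⌊x i * M⌋₊ (M - 1) with h | h
      · rw [min_eq_left h]
        exact ⟨sub_nonneg.2 (Nat.floor_le h0), by linarith [Nat.lt_floor_add_one (x i * M)]⟩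
      · rw [min_eq_right h, hc]
        have : ((M - 1 : ℕ) : ℝ) ≤ x i * M := (Nat.le_floor_iff h0).1 h
        rw [hc] at this
        exact ⟨by linarith, by linarith⟩
    obtain ⟨σ, hσ, hyσ⟩ := Set.mem_iUnion₂.1 (ih hy)
    refine Set.mem_iUnion₂.2 ⟨j :: σ, by simpa using hσ, y, hyσ, ?_⟩
    ext i
    simp [subcubeMap, y, hM'.ne']

/-- The image of the open unit cube in the cube with code `σ`. -/
def openCube : List (Label d M) → Set (EuclideanSpace ℝ (Fin d))
  | [] => {x | ∀ i, x i ∈ Set.Ioo (0 : ℝ) 1}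
  | j :: σ => subcubeMap j '' openCube σ

theorem openCube_subset_cube (σ : List (Label d M)) : openCube σ ⊆ cube σ := by
  induction σ with
  | nil => exact fun x hx i => Set.Ioo_subset_Icc_self (hx i)
  | cons j σ ih => exact Set.image_mono ih

theorem cube_subset_closure_openCube (σ : List (Label d M)) : cube σ ⊆ closure (openCube σ) := by
  induction σ with
  | nil =>
    have h : openCube ([] : List (Label d M)) =
        (EuclideanSpace.equiv (Fin d) ℝ).toHomeomorph ⁻¹'
          Set.pi Set.univ fun _ => Set.Ioo (0 : ℝ) 1 := by
      ext x
      simp only [openCube, Set.mem_preimage, Set.mem_univ_pi]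
      rfl
    rw [h, ← Homeomorph.preimage_closure, closure_pi_set]
    intro x hx
    rw [Set.mem_preimage, Set.mem_univ_pi]
    intro i
    rw [closure_Ioo zero_ne_one]
    exact hx i
  | cons j σ ih =>
    exact (Set.image_mono ih).trans (image_closure_subset_closure_image (continuous_subcubeMap j))

theorem openCube_mem_Ioo (hM : 0 < M) {σ : List (Label d M)} {x : EuclideanSpace ℝ (Fin d)}
    (hx : x ∈ openCube σ) (i : Fin d) : x i ∈ Set.Ioo (0 : ℝ) 1 := by
  have hM' : (0 : ℝ) < M := by exact_mod_cast hM
  induction σ generalizing x with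
  | nil => exact hx i
  | cons j σ ih =>
    obtain ⟨y, hy, rfl⟩ := hx
    have h := ih hy
    have hj : ((j i : ℕ) : ℝ) + 1 ≤ M := by exact_mod_cast (j i).2
    simp only [subcubeMap]
    constructor
    · have := h.1
      positivity
    · rw [div_lt_one hM']
      linarith [h.2]

theorem disjoint_openCube_cube (hM : 0 < M) {σ τ : List (Label d M)}
    (hl : σ.length = τ.length) (hne : σ ≠ τ) : Disjoint (openCube σ) (cube τ) := by
  have hM' : (0 : ℝ) < M := by exact_mod_cast hM
  induction σ generalizing τ with
  | nil =>
    cases τ with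
    | nil => exact absurd rfl hne
    | cons => simp at hl
  | cons j σ ih =>
    cases τ with
    | nil => simp at hl
    | cons j' τ =>
      rw [Set.disjoint_left]
      rintro _ ⟨x, hx, rfl⟩ ⟨y, hy, hxy⟩
      by_cases hj : j' = j
      · subst hj
        have hστ : σ ≠ τ := fun h => hne (by rw [h])
        refine Set.disjoint_left.1 (ih (by simpa using hl) hστ) hx ?_
        rwa [← subcubeMap_injective hM _ hxy]
      · obtain ⟨i, hi⟩ := Function.ne_iff.1 hj
        have h1 := openCube_mem_Ioo hM hx i
        have h2 := cube_subset_unitCube hM τ hy i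
        have h3 := congrArg (fun z : EuclideanSpace ℝ (Fin d) => z i) hxy
        simp only [subcubeMap] at h3
        field_simp at h3
        rcases lt_or_gt_of_ne (fun h => hi (Fin.ext h) : (j' i : ℕ) ≠ (j i : ℕ)) with h | h
        · have : ((j' i : ℕ) : ℝ) + 1 ≤ (j i : ℕ) := by exact_mod_cast h
          linarith [h1.1, h2.2]
        · have : ((j i : ℕ) : ℝ) + 1 ≤ (j' i : ℕ) := by exact_mod_cast h
          linarith [h1.2, h2.1]

end

section

/-! ### The recursive structure of the closed complements -/

variable {Ω : Type*} {d M : ℕ}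

theorem length_of_mem_tree {I : List (Label d M) → Ω → Set (Label d M)} {ω : Ω} {n : ℕ}
    {σ : List (Label d M)} (h : σ ∈ tree I ω n) : σ.length = n := by
  induction n generalizing σ with
  | zero => rw [Set.mem_singleton_iff.1 h, List.length_nil]
  | succ n ih =>
    obtain ⟨ρ, hρ, i, _, rfl⟩ := h
    simp [ih hρ]

/-- The tree grows at the end of words, while the renewal argument splits off the first letter. -/
theorem cons_mem_tree {I : List (Label d M) → Ω → Set (Label d M)} {ω : Ω} {n : ℕ}
    {j : Label d M} {σ : List (Label d M)} :
    j :: σ ∈ tree I ω (n + 1) ↔ j ∈ I [] ω ∧ σ ∈ tree (fun τ => I (j :: τ)) ω n := by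
  induction n generalizing σ with
  | zero =>
    constructor
    · rintro ⟨ρ, hρ, i, hi, h⟩
      obtain rfl : ρ = [] := hρ
      simp only [List.nil_append, List.cons.injEq] at h
      obtain ⟨rfl, rfl⟩ := h
      exact ⟨hi, rfl⟩
    · rintro ⟨hj, hσ⟩
      obtain rfl : σ = [] := hσ
      exact ⟨[], rfl, j, hj, rfl⟩
  | succ n ih =>
    constructor
    · rintro ⟨ρ, hρ, i, hi, h⟩
      cases ρ with
      | nil => simpa using length_of_mem_tree hρ
      | cons j' ρ =>
        simp only [List.cons_append, List.cons.injEq] at h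
        obtain ⟨rfl, rfl⟩ := h
        exact ⟨(ih.1 hρ).1, ρ, (ih.1 hρ).2, i, hi, rfl⟩
    · rintro ⟨hj, ρ, hρ, i, hi, rfl⟩
      exact ⟨j :: ρ, ih.2 ⟨hj, hρ⟩, i, hi, rfl⟩

theorem tree_congr {Ω' : Type*} {I : List (Label d M) → Ω → Set (Label d M)}
    {I' : List (Label d M) → Ω' → Set (Label d M)} {ω : Ω} {ω' : Ω'} {n : ℕ}
    (h : ∀ ρ, ρ.length < n → I ρ ω = I' ρ ω') : tree I ω n = tree I' ω' n := by
  induction n with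
  | zero => rfl
  | succ n ih =>
    ext τ
    simp only [tree, ih fun ρ hρ => h ρ (hρ.trans n.lt_succ_self), Set.mem_ofPred_eq]
    refine exists_congr fun ρ => and_congr_right fun hρ => ?_
    rw [h ρ (by rw [length_of_mem_tree hρ]; exact n.lt_succ_self)]

/-- The union of the cubes of level `n` that have not been kept. -/
def removedSet (I : List (Label d M) → Ω → Set (Label d M)) (n : ℕ) (ω : Ω) :
    Set (EuclideanSpace ℝ (Fin d)) :=
  ⋃ σ ∈ {σ : List (Label d M) | σ.length = n ∧ σ ∉ tree I ω n}, cube σ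

theorem isClosed_cube (σ : List (Label d M)) : IsClosed (cube σ) := by
  refine IsCompact.isClosed ?_
  induction σ with
  | nil => exact isCompact_box _ _
  | cons j σ ih => exact ih.image (continuous_subcubeMap j)

/-- The open cube of a removed word misses every kept cube of the same level, and its closure
contains the closed cube. -/
theorem complSet_eq_removedSet (hM : 0 < M) (I : List (Label d M) → Ω → Set (Label d M)) (n : ℕ)
    (ω : Ω) : complSet I n ω = removedSet I n ω := by
  refine Set.Subset.antisymm (closure_minimal ?_ ?_) (Set.iUnion₂_subset fun σ hσ => ?_)
  · rintro x ⟨hx, hxF⟩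
    rw [unitCube_eq_iUnion hM n] at hx
    obtain ⟨σ, hσ, hxσ⟩ := Set.mem_iUnion₂.1 hx
    exact Set.mem_iUnion₂.2 ⟨σ, ⟨hσ, fun h => hxF (Set.mem_iUnion₂.2 ⟨σ, h, hxσ⟩)⟩, hxσ⟩
  · exact ((List.finite_length_eq _ n).subset fun σ hσ => hσ.1).isClosed_biUnion
      fun σ _ => isClosed_cube σ
  · refine (cube_subset_closure_openCube σ).trans (closure_mono fun x hx => ⟨?_, fun hxF => ?_⟩)
    · exact cube_subset_unitCube hM σ (openCube_subset_cube σ hx)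
    · obtain ⟨τ, hτ, hxτ⟩ := Set.mem_iUnion₂.1 hxF
      refine Set.disjoint_left.1 (disjoint_openCube_cube hM ?_ ?_) hx hxτ
      · rw [hσ.1, length_of_mem_tree hτ]
      · rintro rfl
        exact hσ.2 hτ

theorem removedSet_zero (I : List (Label d M) → Ω → Set (Label d M)) (ω : Ω) :
    removedSet I 0 ω = ∅ := by
  refine Set.eq_empty_of_forall_notMem fun x hx => ?_
  obtain ⟨σ, hσ, -⟩ := Set.mem_iUnion₂.1 hx
  exact hσ.2 (List.length_eq_zero_iff.1 hσ.1)

theorem removedSet_succ (I : List (Label d M) → Ω → Set (Label d M)) (n : ℕ) (ω : Ω) :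
    removedSet I (n + 1) ω = ⋃ j ∈ (Finset.univ : Finset (Label d M)), complPart I (n + 1) j ω := by
  ext x
  simp only [removedSet, complPart, Set.mem_iUnion, Finset.mem_univ, exists_prop, true_and,
    Set.mem_ofPred_eq]
  constructor
  · rintro ⟨σ, ⟨h1, h2⟩, hx⟩
    cases σ with
    | nil => simp at h1
    | cons j σ => exact ⟨j, j :: σ, ⟨h1, rfl, h2⟩, hx⟩
  · rintro ⟨j, σ, ⟨h1, -, h2⟩, hx⟩
    exact ⟨σ, ⟨h1, h2⟩, hx⟩

theorem complPart_succ_of_mem {I : List (Label d M) → Ω → Set (Label d M)} {j : Label d M} {ω : Ω}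
    (n : ℕ) (h : j ∈ I [] ω) :
    complPart I (n + 1) j ω = subcubeMap j '' removedSet (fun τ => I (j :: τ)) n ω := by
  simp only [removedSet, complPart, Set.image_iUnion₂]
  ext x
  simp only [Set.mem_iUnion, exists_prop, Set.mem_ofPred_eq]
  constructor
  · rintro ⟨σ, ⟨h1, h2, h3⟩, hx⟩
    cases σ with
    | nil => simp at h1
    | cons j' σ =>
      obtain rfl : j' = j := by simpa using h2
      rw [cons_mem_tree, not_and] at h3
      exact ⟨σ, ⟨by simpa using h1, h3 h⟩, hx⟩
  · rintro ⟨σ, ⟨h1, h2⟩, hx⟩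
    exact ⟨j :: σ, ⟨by simpa using h1, rfl, fun h3 => h2 (cons_mem_tree.1 h3).2⟩, hx⟩

theorem complPart_succ_of_notMem (hM : 0 < M) {I : List (Label d M) → Ω → Set (Label d M)}
    {j : Label d M} {ω : Ω} (n : ℕ) (h : j ∉ I [] ω) :
    complPart I (n + 1) j ω = subcubeMap j '' unitCube d := by
  rw [unitCube_eq_iUnion hM n]
  simp only [complPart, Set.image_iUnion₂]
  ext x
  simp only [Set.mem_iUnion, exists_prop, Set.mem_ofPred_eq]
  constructor
  · rintro ⟨σ, ⟨h1, h2, -⟩, hx⟩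
    cases σ with
    | nil => simp at h1
    | cons j' σ =>
      obtain rfl : j' = j := by simpa using h2
      exact ⟨σ, by simpa using h1, hx⟩
  · rintro ⟨σ, h1, hx⟩
    exact ⟨j :: σ, ⟨by simpa using h1, rfl, fun h3 => h (cons_mem_tree.1 h3).1⟩, hx⟩

theorem isCubical_removedSet (hM : 0 < M) (I : List (Label d M) → Ω → Set (Label d M)) (n : ℕ)
    (ω : Ω) : IsCubical (1 / ((M ^ n : ℕ) : ℝ)) (removedSet I n ω) :=
  IsCubical.biUnion _ fun σ hσ => hσ.1 ▸ isCubical_cube hM σ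

theorem isCubical_complPart (hM : 0 < M) (I : List (Label d M) → Ω → Set (Label d M)) (n : ℕ)
    (j : Label d M) (ω : Ω) : IsCubical (1 / ((M ^ n : ℕ) : ℝ)) (complPart I n j ω) :=
  IsCubical.biUnion _ fun σ hσ => hσ.1 ▸ isCubical_cube hM σ

theorem isPolyconvex_removedSet (hM : 0 < M) (I : List (Label d M) → Ω → Set (Label d M)) (n : ℕ)
    (ω : Ω) : IsPolyconvex (removedSet I n ω) :=
  (isCubical_removedSet hM I n ω).isPolyconvex (pow_pos hM n)

theorem isCubical_unitCube (hM : 0 < M) : IsCubical (1 / ((M ^ 0 : ℕ) : ℝ)) (unitCube d) :=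
  isCubical_cube hM ([] : List (Label d M))

theorem intrinsicVolume_subcubeMap_image (hM : 0 < M) (j : Label d M)
    {K : Set (EuclideanSpace ℝ (Fin d))} (hK : IsPolyconvex K) (k : Fin (d + 1)) :
    intrinsicVolume k (subcubeMap j '' K) = (1 / (M : ℝ)) ^ (k : ℕ) * intrinsicVolume k K := by
  have hM' : (0 : ℝ) < M := by exact_mod_cast hM
  rw [subcubeMap_eq, intrinsicVolume_image hK (by positivity)]

theorem complPart_subset (hM : 0 < M) (I : List (Label d M) → Ω → Set (Label d M)) (n : ℕ)
    (j : Label d M) (ω : Ω) : complPart I (n + 1) j ω ⊆ subcubeMap j '' unitCube d := by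
  by_cases h : j ∈ I [] ω
  · rw [complPart_succ_of_mem n h]
    exact Set.image_mono (isCubical_removedSet hM _ n ω).1
  · rw [complPart_succ_of_notMem hM n h]

/-- The intersections of the parts in different subcubes have intrinsic volumes of lower order. -/
theorem exists_abs_intrinsicVolume_iInter_complPart_le (hM : 0 < M) (k : Fin (d + 1)) :
    ∃ C : ℝ, 0 ≤ C ∧ ∀ (I : List (Label d M) → Ω → Set (Label d M)) (T : Finset (Label d M)),
      2 ≤ T.card → ∀ (n : ℕ) (ω : Ω),
      |intrinsicVolume k (⋂ j ∈ T, complPart I (n + 1) j ω)| ≤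
        C * ((M : ℝ) ^ (n + 1)) ^ (d - 1) * (1 / (M : ℝ) ^ (n + 1)) ^ (k : ℕ) := by
  have hM' : (0 : ℝ) < M := by exact_mod_cast hM
  obtain ⟨C, hC0, hC⟩ := exists_abs_intrinsicVolume_cubical_le d k
  refine ⟨C, hC0, fun I T hT n ω => ?_⟩
  obtain ⟨j, hj, j', hj', hne⟩ := Finset.one_lt_card.1 hT
  obtain ⟨i, hi⟩ := Function.ne_iff.1 hne
  wlog hlt : (j i : ℕ) < (j' i : ℕ) generalizing j j'
  · exact this j' hj' j hj hne.symm hi.symm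
      (lt_of_le_of_ne (not_lt.1 hlt) fun h => hi (Fin.ext h.symm))
  -- Since `j i < j' i`, the two subcubes can meet only where the `i`-th coordinate is `j' i / M`,
  -- which is `j' i * M ^ n` steps of the grid of mesh `1 / M ^ (n + 1)`.
  have h := hC (M ^ (n + 1)) (pow_pos hM _) (⋂ j ∈ T, complPart I (n + 1) j ω)
    (IsCubical.biInter ⟨j, hj⟩ fun j _ => isCubical_complPart hM I (n + 1) j ω) i
    ((j' i : ℕ) * M ^ n) ?_
  · simpa only [Nat.cast_pow] using h
  · intro x hx
    obtain ⟨y, hy, rfl⟩ := complPart_subset hM I n j ω (Set.mem_iInter₂.1 hx j hj)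
    obtain ⟨z, hz, hzy⟩ := complPart_subset hM I n j' ω (Set.mem_iInter₂.1 hx j' hj')
    have h1 := (subcubeMap_mem_unitCube hM j hy i).2
    have h2 := (subcubeMap_mem_unitCube hM j' hz i).1
    rw [hzy] at h2
    have h3 : (((j i : ℕ) : ℝ) + 1) / M ≤ ((j' i : ℕ) : ℝ) / M := by
      gcongr
      exact_mod_cast hlt
    rw [le_antisymm (h1.trans h3) h2]
    push_cast
    field_simp
    ring

end

section

/-! ### Expectations -/

/-! ### Functions of finitely many Boolean coordinates -/

section DependsOn

variable {Q : Type*} {W : Finset Q} {f : (Q → Prop) → ℝ}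

/-- Factoring through the finite type `W → Prop` makes measurability and boundedness automatic,
whatever `f` is. -/
theorem exists_eq_comp_restrict (h : DependsOn f (W : Set Q)) :
    ∃ g : (W → Prop) → ℝ, f = fun x => g fun q => x q := by
  classical
  refine ⟨fun z => f fun q => if hq : q ∈ W then z ⟨q, hq⟩ else False, funext fun x => h ?_⟩
  intro q hq
  rw [dif_pos (Finset.mem_coe.1 hq)]

theorem measurable_of_dependsOn (h : DependsOn f (W : Set Q)) : Measurable f := by
  obtain ⟨g, rfl⟩ := exists_eq_comp_restrict h
  exact (measurable_of_countable g).comp (measurable_pi_lambda _ fun q => measurable_pi_apply _)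

theorem integrable_comp_of_dependsOn (h : DependsOn f (W : Set Q)) {Ω : Type*} [MeasurableSpace Ω]
    {μ : Measure Ω} [IsProbabilityMeasure μ] {X : Ω → Q → Prop} (hX : Measurable X) :
    Integrable (fun ω => f (X ω)) μ := by
  obtain ⟨C, hC⟩ : ∃ C, ∀ x, ‖f x‖ ≤ C := by
    obtain ⟨g, rfl⟩ := exists_eq_comp_restrict h
    obtain ⟨C, hC⟩ := (Set.finite_range fun z => ‖g z‖).bddAbove
    exact ⟨C, fun x => hC ⟨_, rfl⟩⟩
  exact Integrable.of_bound ((measurable_of_dependsOn h).comp hX).aestronglyMeasurable C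
    (Eventually.of_forall fun ω => hC _)

end DependsOn

variable {Ω : Type*} {d M : ℕ}

/-- The percolation on the space of all configurations. -/
def canonical (d M : ℕ) (σ : List (Label d M)) (x : List (Label d M) × Label d M → Prop) :
    Set (Label d M) := {j | x (σ, j)}

/-- The configuration of a percolation. -/
def configuration (I : List (Label d M) → Ω → Set (Label d M)) (ω : Ω) :
    List (Label d M) × Label d M → Prop := fun q => q.2 ∈ I q.1 ω

theorem tree_canonical (I : List (Label d M) → Ω → Set (Label d M)) (n : ℕ) (ω : Ω) :
    tree (canonical d M) (configuration I ω) n = tree I ω n := tree_congr fun _ _ => rfl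

theorem removedSet_canonical (I : List (Label d M) → Ω → Set (Label d M)) (n : ℕ) (ω : Ω) :
    removedSet (canonical d M) n (configuration I ω) = removedSet I n ω := by
  simp only [removedSet, tree_canonical]

theorem complPart_canonical (I : List (Label d M) → Ω → Set (Label d M)) (n : ℕ) (j : Label d M)
    (ω : Ω) : complPart (canonical d M) n j (configuration I ω) = complPart I n j ω := by
  simp only [complPart, tree_canonical]

open Classical in
/-- The pairs `(σ, j)` with `σ` shorter than `n`. -/
def shortWords (d M n : ℕ) : Finset (List (Label d M) × Label d M) :=
  (List.finite_length_lt (Label d M) n).toFinset ×ˢ Finset.univ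

theorem mem_shortWords {n : ℕ} {q : List (Label d M) × Label d M} :
    q ∈ shortWords d M n ↔ q.1.length < n := by
  simp [shortWords]

theorem tree_canonical_congr {n : ℕ} {x y : List (Label d M) × Label d M → Prop}
    (h : ∀ q ∈ (shortWords d M n : Set _), x q = y q) :
    tree (canonical d M) x n = tree (canonical d M) y n := by
  refine tree_congr fun ρ hρ => ?_
  ext j
  have := h (ρ, j) (Finset.mem_coe.2 (mem_shortWords.2 hρ))
  change x (ρ, j) ↔ y (ρ, j)
  rw [this]

theorem dependsOn_intrinsicVolume_removedSet (n : ℕ) (k : Fin (d + 1)) :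
    DependsOn (fun x => intrinsicVolume k (removedSet (canonical d M) n x))
      (shortWords d M n : Set _) := by
  intro x y h
  simp only [removedSet, tree_canonical_congr h]

theorem dependsOn_intrinsicVolume_iInter_complPart (n : ℕ) (T : Finset (Label d M))
    (k : Fin (d + 1)) :
    DependsOn (fun x => intrinsicVolume k (⋂ j ∈ T, complPart (canonical d M) n j x))
      (shortWords d M n : Set _) := by
  intro x y h
  simp only [complPart, tree_canonical_congr h]

variable [MeasurableSpace Ω] {μ : Measure Ω} {p : ℝ} {I : List (Label d M) → Ω → Set (Label d M)}

theorem IsPercolation.measurable_apply (hI : IsPercolation μ p I)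
    (q : List (Label d M) × Label d M) : Measurable fun ω => q.2 ∈ I q.1 ω :=
  measurableSet_setOfPred.1 (hI.measurableSet q.1 q.2)

theorem IsPercolation.measurable_configuration (hI : IsPercolation μ p I) :
    Measurable (configuration I) := measurable_pi_lambda _ hI.measurable_apply

theorem IsPercolation.iIndepFun (hI : IsPercolation μ p I) :
    iIndepFun (fun (q : List (Label d M) × Label d M) ω => q.2 ∈ I q.1 ω) μ := by
  rw [iIndepFun_iff_iIndep]
  have h := hI.indep
  rw [iIndepSet_iff_iIndep] at h
  convert h using 2 with q
  rw [MeasurableSpace.generateFrom_singleton]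
  rfl

theorem IsPercolation.map_apply_eq [IsProbabilityMeasure μ]
    {I' : List (Label d M) → Ω → Set (Label d M)}
    (hI : IsPercolation μ p I) (hI' : IsPercolation μ p I')
    (q : List (Label d M) × Label d M) :
    μ.map (fun ω => q.2 ∈ I q.1 ω) = μ.map (fun ω => q.2 ∈ I' q.1 ω) := by
  refine Measure.ext_of_singleton fun P => ?_
  classical
  rw [Measure.map_apply (hI.measurable_apply q) (MeasurableSet.singleton P),
    Measure.map_apply (hI'.measurable_apply q) (MeasurableSet.singleton P)]
  have e : ∀ J : List (Label d M) → Ω → Set (Label d M), IsPercolation μ p J →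
      μ ((fun ω => q.2 ∈ J q.1 ω) ⁻¹' {P}) = if P then ENNReal.ofReal p else
        1 - ENNReal.ofReal p := by
    intro J hJ
    have h1 := hJ.prob q.1 q.2
    by_cases hP : P
    · rw [if_pos hP, ← h1]
      congr 1
      ext ω
      simp [hP]
    · rw [if_neg hP, ← h1, ← prob_compl_eq_one_sub (hJ.measurableSet q.1 q.2)]
      congr 1
      ext ω
      simp [hP]
  rw [e I hI, e I' hI']

/-- The law of a percolation is determined by its parameters. -/
theorem IsPercolation.integral_eq [IsProbabilityMeasure μ]
    {I' : List (Label d M) → Ω → Set (Label d M)}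
    (hI : IsPercolation μ p I) (hI' : IsPercolation μ p I')
    {f : (List (Label d M) × Label d M → Prop) → ℝ} (hf : Measurable f) :
    ∫ ω, f (configuration I ω) ∂μ = ∫ ω, f (configuration I' ω) ∂μ := by
  rw [← integral_map hI.measurable_configuration.aemeasurable hf.aestronglyMeasurable,
    ← integral_map hI'.measurable_configuration.aemeasurable hf.aestronglyMeasurable]
  have h1 := hI.iIndepFun.map_fun_eq_infinitePi_map hI.measurable_apply
  have h2 := hI'.iIndepFun.map_fun_eq_infinitePi_map hI'.measurable_apply
  have h3 : μ.map (configuration I) = μ.map (configuration I') := by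
    refine h1.trans (Eq.trans ?_ h2.symm)
    congr 1
    funext q
    exact hI.map_apply_eq hI' q
  rw [h3]

/-- The percolation in a subcube of the first level. -/
theorem IsPercolation.cons (hI : IsPercolation μ p I) (j : Label d M) :
    IsPercolation μ p fun τ => I (j :: τ) where
  measurableSet σ := hI.measurableSet (j :: σ)
  prob σ := hI.prob (j :: σ)
  indep := by
    have h := hI.indep
    rw [iIndepSet_iff_iIndep] at h ⊢
    have hinj : Function.Injective
        (fun q : List (Label d M) × Label d M => (j :: q.1, q.2)) := by
      rintro ⟨a, b⟩ ⟨a', b'⟩ h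
      simpa using h
    exact iIndep.precomp hinj h

/-- The decision about `J_j` is the coordinate `([], j)`, while the percolation inside `J_j` only
uses coordinates whose word begins with `j`. -/
theorem IsPercolation.indepFun_root (hI : IsPercolation μ p I) (j : Label d M) {n : ℕ}
    {f : (List (Label d M) × Label d M → Prop) → ℝ}
    (hf : DependsOn f (shortWords d M n : Set (List (Label d M) × Label d M))) :
    IndepFun ({ω | j ∈ I [] ω}.indicator (1 : Ω → ℝ))
      (fun ω => f (configuration (fun τ => I (j :: τ)) ω)) μ := by
  classical
  let S : Finset (List (Label d M) × Label d M) := {([], j)}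
  let T : Finset (List (Label d M) × Label d M) :=
    (shortWords d M n).image fun q => (j :: q.1, q.2)
  have hST : Disjoint S T := by
    rw [Finset.disjoint_singleton_left]
    simp [T]
  have h := hI.iIndepFun.indepFun_finset S T hST hI.measurable_apply
  obtain ⟨g, hg⟩ := exists_eq_comp_restrict hf
  let φ : (S → Prop) → ℝ := fun z => if z ⟨([], j), Finset.mem_singleton_self _⟩ then 1 else 0
  let ψ : (T → Prop) → ℝ := fun z => g fun q =>
    z ⟨(j :: q.1.1, q.1.2), Finset.mem_image_of_mem _ q.2⟩
  have h2 := h.comp (measurable_of_countable φ) (measurable_of_countable ψ)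
  convert h2 using 1
  · funext ω
    by_cases hω : j ∈ I [] ω <;> simp [φ, hω]
  · rw [hg]
    rfl

theorem IsPercolation.integral_intrinsicVolume_complPart [IsProbabilityMeasure μ] (hM : 0 < M)
    (hp : 0 ≤ p) (hI : IsPercolation μ p I) (n : ℕ) (j : Label d M) (k : Fin (d + 1)) :
    ∫ ω, intrinsicVolume k (complPart I (n + 1) j ω) ∂μ =
      (1 / (M : ℝ)) ^ (k : ℕ) * (p * ∫ ω, intrinsicVolume k (removedSet I n ω) ∂μ +
        (1 - p) * intrinsicVolume k (unitCube d)) := by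
  let f : (List (Label d M) × Label d M → Prop) → ℝ := fun x =>
    intrinsicVolume k (removedSet (canonical d M) n x)
  have hf : DependsOn f (shortWords d M n : Set (List (Label d M) × Label d M)) :=
    dependsOn_intrinsicVolume_removedSet n k
  let J : List (Label d M) → Ω → Set (Label d M) := fun τ => I (j :: τ)
  have hJ : IsPercolation μ p J := hI.cons j
  let A : Set Ω := {ω | j ∈ I [] ω}
  have hA : MeasurableSet A := hI.measurableSet [] j
  have hAp : μ.real A = p := by
    rw [Measure.real, hI.prob, ENNReal.toReal_ofReal hp]
  have hfJ : Integrable (fun ω => f (configuration J ω)) μ :=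
    integrable_comp_of_dependsOn hf hJ.measurable_configuration
  have hint : ∫ ω, f (configuration J ω) ∂μ = ∫ ω, intrinsicVolume k (removedSet I n ω) ∂μ := by
    rw [hJ.integral_eq hI (measurable_of_dependsOn hf)]
    simp only [f, removedSet_canonical]
  set q := intrinsicVolume k (unitCube d)
  -- If `j` is kept, the part is a scaled complement of the percolation `J`; if not, it is the whole
  -- subcube.
  have hpt : ∀ ω, intrinsicVolume k (complPart I (n + 1) j ω) = (1 / (M : ℝ)) ^ (k : ℕ) *
      (A.indicator 1 ω * f (configuration J ω) + (q - q * A.indicator 1 ω)) := by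
    intro ω
    by_cases hω : j ∈ I [] ω
    · have hωA : ω ∈ A := hω
      rw [complPart_succ_of_mem n hω, intrinsicVolume_subcubeMap_image hM j
        (isPolyconvex_removedSet hM _ n ω)]
      simp [hωA, f, J, removedSet_canonical]
    · have hωA : ω ∉ A := hω
      rw [complPart_succ_of_notMem hM n hω, intrinsicVolume_subcubeMap_image hM j
        ((isCubical_unitCube hM).isPolyconvex (pow_pos hM 0))]
      simp [hωA, q]
  have hA1 : Integrable (A.indicator (1 : Ω → ℝ)) μ :=
    (integrable_const (1 : ℝ)).indicator hA
  have hind := hI.indepFun_root j hf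
  have hprod : ∫ ω, A.indicator 1 ω * f (configuration J ω) ∂μ =
      p * ∫ ω, f (configuration J ω) ∂μ := by
    rw [hind.integral_fun_mul_eq_mul_integral hA1.aestronglyMeasurable hfJ.aestronglyMeasurable,
      integral_indicator_one hA, hAp]
  have hprodint : Integrable (fun ω => A.indicator 1 ω * f (configuration J ω)) μ :=
    hind.integrable_mul hA1 hfJ
  simp only [hpt]
  have hsub : ∫ ω, (q - q * A.indicator (1 : Ω → ℝ) ω) ∂μ = q - q * p := by
    rw [integral_sub (integrable_const q) (hA1.const_mul q), integral_const_mul,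
      integral_indicator_one hA, hAp]
    simp
  have hsubint : Integrable (fun ω => q - q * A.indicator (1 : Ω → ℝ) ω) μ :=
    (integrable_const q).sub (hA1.const_mul q)
  rw [integral_const_mul, integral_add hprodint hsubint, hprod, hsub, hint]
  ring

end

/-! ### The renewal equation and its solution -/

section

variable {Ω : Type*} {d M : ℕ} [MeasurableSpace Ω] {μ : Measure Ω} [IsProbabilityMeasure μ] {p : ℝ}
  {I : List (Label d M) → Ω → Set (Label d M)}

theorem IsPercolation.integrable_intrinsicVolume_removedSet (hI : IsPercolation μ p I) (n : ℕ)
    (k : Fin (d + 1)) : Integrable (fun ω => intrinsicVolume k (removedSet I n ω)) μ := by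
  have := integrable_comp_of_dependsOn (μ := μ) (dependsOn_intrinsicVolume_removedSet n k)
    hI.measurable_configuration
  simpa only [removedSet_canonical] using this

theorem IsPercolation.integrable_intrinsicVolume_iInter_complPart (hI : IsPercolation μ p I)
    (n : ℕ) (T : Finset (Label d M)) (k : Fin (d + 1)) :
    Integrable (fun ω => intrinsicVolume k (⋂ j ∈ T, complPart I n j ω)) μ := by
  have := integrable_comp_of_dependsOn (μ := μ) (dependsOn_intrinsicVolume_iInter_complPart n T k)
    hI.measurable_configuration
  simpa only [complPart_canonical] using this

theorem sum_filter_nonempty_eq {ι : Type*} [Fintype ι] [DecidableEq ι] (f : Finset ι → ℝ) :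
    ∑ T ∈ (Finset.univ : Finset ι).powerset with T.Nonempty, f T =
      ∑ j, f {j} + ∑ T : Finset ι with 2 ≤ T.card, f T := by
  have h : (Finset.univ : Finset ι).powerset.filter (·.Nonempty) =
      (Finset.univ.image fun j : ι => ({j} : Finset ι)) ∪
        Finset.univ.filter fun T : Finset ι => 2 ≤ T.card := by
    ext T
    simp only [Finset.powerset_univ, Finset.mem_filter, Finset.mem_univ, true_and,
      Finset.mem_union, Finset.mem_image, ← Finset.card_pos]
    constructor
    · intro hT
      rcases (Nat.succ_le_of_lt hT).eq_or_lt with h1 | h1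
      · obtain ⟨j, rfl⟩ := Finset.card_eq_one.1 h1.symm
        exact Or.inl ⟨j, rfl⟩
      · exact Or.inr h1
    · rintro (⟨j, rfl⟩ | hT)
      · simp
      · omega
  rw [h, Finset.sum_union, Finset.sum_image fun a _ b _ hab => Finset.singleton_injective hab]
  rw [Finset.disjoint_left]
  intro T hT hT'
  obtain ⟨j, -, rfl⟩ := Finset.mem_image.1 hT
  simp at hT'

/-- The renewal equation for the expected intrinsic volumes of the closed complements. -/
theorem IsPercolation.integral_intrinsicVolume_removedSet_succ (hM : 0 < M) (hp : 0 ≤ p)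
    (hI : IsPercolation μ p I) (n : ℕ) (k : Fin (d + 1)) :
    ∫ ω, intrinsicVolume k (removedSet I (n + 1) ω) ∂μ =
      (M : ℝ) ^ (d - (k : ℕ)) * (p * ∫ ω, intrinsicVolume k (removedSet I n ω) ∂μ +
        (1 - p) * intrinsicVolume k (unitCube d)) +
      ∑ T : Finset (Label d M) with 2 ≤ T.card, (-1 : ℝ) ^ (T.card - 1) *
        ∫ ω, intrinsicVolume k (⋂ j ∈ T, complPart I (n + 1) j ω) ∂μ := by
  have hM' : (M : ℝ) ≠ 0 := by exact_mod_cast hM.ne'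
  have hpt : ∀ ω, intrinsicVolume k (removedSet I (n + 1) ω) =
      ∑ T ∈ (Finset.univ : Finset (Label d M)).powerset with T.Nonempty,
        (-1 : ℝ) ^ (T.card - 1) * intrinsicVolume k (⋂ j ∈ T, complPart I (n + 1) j ω) := by
    intro ω
    rw [removedSet_succ]
    refine intrinsicVolume_biUnion _ _ ?_ (fun T hT => ?_) k
    · rw [← removedSet_succ]
      exact isPolyconvex_removedSet hM I _ ω
    · exact (IsCubical.biInter hT fun j _ => isCubical_complPart hM I (n + 1) j ω).isPolyconvex
        (pow_pos hM _)
  simp only [hpt]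
  rw [integral_finsetSum _ fun T _ =>
    (hI.integrable_intrinsicVolume_iInter_complPart (n + 1) T k).const_mul _]
  simp only [integral_const_mul]
  rw [sum_filter_nonempty_eq]
  congr 1
  simp only [Finset.card_singleton, Nat.sub_self, pow_zero, one_mul, Finset.mem_singleton,
    Set.iInter_iInter_eq_left, hI.integral_intrinsicVolume_complPart hM hp]
  rw [Finset.sum_const, Finset.card_univ, nsmul_eq_mul, ← mul_assoc]
  congr 1
  have hk : d = (k : ℕ) + (d - (k : ℕ)) := by omega
  have hd : (M : ℝ) ^ d = (M : ℝ) ^ (k : ℕ) * (M : ℝ) ^ (d - (k : ℕ)) := by rw [← pow_add, ← hk]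
  simp only [Fintype.card_pi, Fintype.card_fin, Finset.prod_const, Finset.card_univ]
  rw [Nat.cast_pow, hd, one_div, inv_pow]
  field_simp

/-- Immediate from `M ^ D = M ^ d * p`. It turns the real powers of `r` into powers of the inverse
of the factor in the renewal equation. -/
theorem rpow_dimension_sub (hM : 2 ≤ M) (hp : 0 < p) (k : Fin (d + 1)) :
    (1 / (M : ℝ)) ^ (dimension d M p - ((k : ℕ) : ℝ)) = ((M : ℝ) ^ (d - (k : ℕ)) * p)⁻¹ := by
  have hM1 : (1 : ℝ) < M := by exact_mod_cast hM
  have hM0 : (0 : ℝ) < M := by linarith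
  have hD : (M : ℝ) ^ dimension d M p = (M : ℝ) ^ d * p := by
    rw [dimension, Real.rpow_def_of_pos hM0, mul_div_cancel₀ _ (Real.log_pos hM1).ne',
      Real.exp_log (by positivity)]
  have hk : d = (k : ℕ) + (d - (k : ℕ)) := by omega
  have hd : (M : ℝ) ^ d = (M : ℝ) ^ (k : ℕ) * (M : ℝ) ^ (d - (k : ℕ)) := by rw [← pow_add, ← hk]
  rw [one_div, Real.inv_rpow hM0.le, Real.rpow_sub hM0, hD, Real.rpow_natCast, hd]
  congr 1
  field_simp

theorem one_lt_of_lt_dimension (hM : 2 ≤ M) (hp : 0 < p) {k : Fin (d + 1)}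
    (hk : ((k : ℕ) : ℝ) < dimension d M p) : 1 < (M : ℝ) ^ (d - (k : ℕ)) * p := by
  have hM1 : (1 : ℝ) < M := by exact_mod_cast hM
  have hM0 : (0 : ℝ) < M := by linarith
  have h1 : (1 / (M : ℝ)) ^ (dimension d M p - ((k : ℕ) : ℝ)) < 1 :=
    Real.rpow_lt_one (by positivity) ((div_lt_one hM0).2 hM1) (sub_pos.2 hk)
  rw [rpow_dimension_sub hM hp] at h1
  exact (inv_lt_one₀ (by positivity)).1 h1

theorem IsPercolation.summable_integral_iInter_complPart (hM : 2 ≤ M) (hp : 1 / (M : ℝ) < p)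
    (hp1 : p ≤ 1) (hI : IsPercolation μ p I) {k : Fin (d + 1)}
    (hk : ((k : ℕ) : ℝ) < dimension d M p) (T : Finset (Label d M)) (hT : 2 ≤ T.card) :
    Summable fun n : ℕ => (((M : ℝ) ^ (d - (k : ℕ)) * p)⁻¹) ^ (n + 1) *
      ∫ ω, intrinsicVolume k (⋂ j ∈ T, complPart I (n + 1) j ω) ∂μ := by
  have hM0 : (0 : ℝ) < M := by exact_mod_cast (by omega : 0 < M)
  have hp0 : 0 < p := lt_trans (by positivity) hp
  have hc := one_lt_of_lt_dimension hM hp0 hk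
  -- For `d = 0` the condition `k < D` would force `p > 1`. Positivity of `d` makes the truncated `d
  -- - 1` below a true subtraction.
  have hd : d ≠ 0 := by
    rintro rfl
    simp only [Nat.zero_sub, pow_zero, one_mul] at hc
    linarith
  obtain ⟨C, hC0, hC⟩ := exists_abs_intrinsicVolume_iInter_complPart_le (Ω := Ω) (d := d)
    (M := M) (by omega) k
  have hint : ∀ n : ℕ, |∫ ω, intrinsicVolume k (⋂ j ∈ T, complPart I (n + 1) j ω) ∂μ| ≤
      C * ((M : ℝ) ^ (n + 1)) ^ (d - 1) * (1 / (M : ℝ) ^ (n + 1)) ^ (k : ℕ) := by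
    intro n
    have := norm_integral_le_of_norm_le_const (μ := μ)
      (f := fun ω => intrinsicVolume k (⋂ j ∈ T, complPart I (n + 1) j ω))
      (Eventually.of_forall fun ω => hC I T hT n ω)
    simpa using this
  have hq : ((M : ℝ) * p)⁻¹ < 1 := by
    refine inv_lt_one_of_one_lt₀ ?_
    rwa [div_lt_iff₀' hM0] at hp
  have hgeo : Summable fun n : ℕ => C * (((M : ℝ) * p)⁻¹) ^ (n + 1) :=
    ((summable_nat_add_iff 1).2 (summable_geometric_of_lt_one (by positivity) hq)).mul_left C
  refine Summable.of_norm_bounded hgeo fun n => ?_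
  -- The ratio of the dominating series does not depend on `k`: one power of `M` remains because the
  -- intersections have codimension one.
  have hratio : ((M : ℝ) ^ (d - (k : ℕ)) * p)⁻¹ * ((M : ℝ) ^ (d - 1) * (1 / (M : ℝ)) ^ (k : ℕ)) =
      ((M : ℝ) * p)⁻¹ := by
    have h1 : (M : ℝ) ^ (d - (k : ℕ)) * (M : ℝ) ^ (k : ℕ) = (M : ℝ) ^ (d - 1) * M := by
      rw [← pow_add, ← pow_succ]
      congr 1
      omega
    rw [one_div, inv_pow]
    field_simp
    linarith
  rw [norm_mul, Real.norm_eq_abs, Real.norm_eq_abs, abs_of_pos (by positivity)]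
  refine (mul_le_mul_of_nonneg_left (hint n) (by positivity)).trans (le_of_eq ?_)
  rw [← hratio, mul_pow, mul_pow, ← pow_mul, ← pow_mul, ← pow_mul, one_div_pow, one_div_pow,
    ← pow_mul, mul_comm (n + 1) (d - 1), mul_comm (n + 1) (k : ℕ)]
  ring

theorem IsPercolation.tendsto_integral_intrinsicVolume_removedSet (hM : 2 ≤ M)
    (hp : 1 / (M : ℝ) < p) (hp1 : p ≤ 1) (hI : IsPercolation μ p I) {k : Fin (d + 1)}
    (hk : ((k : ℕ) : ℝ) < dimension d M p) {c : ℝ} (hc_def : c = (M : ℝ) ^ (d - (k : ℕ)) * p) :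
    Tendsto (fun n : ℕ => c⁻¹ ^ n * ∫ ω, intrinsicVolume k (removedSet I n ω) ∂μ) atTop
      (𝓝 (intrinsicVolume k (unitCube d) * ((M : ℝ) ^ (d - (k : ℕ)) * (1 - p) / (c - 1)) +
        ∑ T : Finset (Label d M) with 2 ≤ T.card, (-1 : ℝ) ^ (T.card - 1) *
          ∑' n : ℕ, c⁻¹ ^ (n + 1) *
            ∫ ω, intrinsicVolume k (⋂ j ∈ T, complPart I (n + 1) j ω) ∂μ)) := by
  have hM0 : 0 < M := by omega
  have hM' : (0 : ℝ) < M := by exact_mod_cast hM0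
  have hp0 : 0 < p := lt_trans (by positivity) hp
  have hc : 1 < c := hc_def ▸ one_lt_of_lt_dimension hM hp0 hk
  have hsum := fun T hT => hI.summable_integral_iInter_complPart hM hp hp1 hk T hT
  rw [← hc_def] at hsum
  set q := intrinsicVolume k (unitCube d)
  set B : ℝ := (M : ℝ) ^ (d - (k : ℕ)) * (1 - p) * q with hB
  have hgeo : HasSum (fun n : ℕ => c⁻¹ ^ (n + 1) * B)
      (q * ((M : ℝ) ^ (d - (k : ℕ)) * (1 - p) / (c - 1))) := by
    have h := (hasSum_geometric_of_lt_one (by positivity) (inv_lt_one_of_one_lt₀ hc)).mul_left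
      (c⁻¹ * B)
    have e1 : (fun n : ℕ => c⁻¹ ^ (n + 1) * B) = fun n => c⁻¹ * B * c⁻¹ ^ n := funext fun n => by
      ring
    have e2 : q * ((M : ℝ) ^ (d - (k : ℕ)) * (1 - p) / (c - 1)) = c⁻¹ * B * (1 - c⁻¹)⁻¹ := by
      have h2 : c⁻¹ * (1 - c⁻¹)⁻¹ = (c - 1)⁻¹ := by
        rw [← mul_inv, mul_sub, mul_one, mul_inv_cancel₀ (by positivity)]
      rw [hB, mul_right_comm, h2]
      ring
    rwa [e1, e2]
  have hseries := hgeo.add (hasSum_sum fun T (hT : T ∈ Finset.univ.filter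
    fun T : Finset (Label d M) => 2 ≤ T.card) =>
      ((hsum T (Finset.mem_filter.1 hT).2).hasSum.mul_left ((-1 : ℝ) ^ (T.card - 1))))
  -- The rescaled expectation at level `n` equals the `n`-th partial sum exactly. The empty sum
  -- corresponds to `C_0 = ∅`, and the summand with index `n` comes from the step to level `n + 1`.
  convert hseries.tendsto_sum_nat using 2 with n
  induction n with
  | zero => simp [removedSet_zero, intrinsicVolume_empty]
  | succ n ih =>
    rw [Finset.sum_range_succ, ← ih,
      hI.integral_intrinsicVolume_removedSet_succ hM0 hp0.le n k, mul_add, Finset.mul_sum]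
    -- The extra factor `c⁻¹` cancels `M ^ (d - k) * p`, so the previous term returns with
    -- coefficient one.
    have hstep : c⁻¹ ^ (n + 1) * ((M : ℝ) ^ (d - (k : ℕ)) *
        (p * ∫ ω, intrinsicVolume k (removedSet I n ω) ∂μ + (1 - p) * q)) =
        c⁻¹ ^ n * ∫ ω, intrinsicVolume k (removedSet I n ω) ∂μ + c⁻¹ ^ (n + 1) * B := by
      have h1 : c⁻¹ * c = 1 := inv_mul_cancel₀ (by positivity)
      calc _ = c⁻¹ ^ n * (c⁻¹ * c) * ∫ ω, intrinsicVolume k (removedSet I n ω) ∂μ +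
            c⁻¹ ^ (n + 1) * B := by
              rw [hB, hc_def]
              ring
        _ = _ := by rw [h1, mul_one]
    rw [hstep, add_assoc]
    congr 2
    refine Finset.sum_congr rfl fun T _ => ?_
    ring

end

end FractalPercolation

end

theorem theorem5 {Ω : Type*} [MeasurableSpace Ω] (μ : Measure Ω) [IsProbabilityMeasure μ]
    (d M : ℕ) (hM : 2 ≤ M) (p : ℝ) (hp : 1 / (M : ℝ) < p) (hp1 : p ≤ 1)
    (I : List (FractalPercolation.Label d M) → Ω → Set (FractalPercolation.Label d M))
    (hI : FractalPercolation.IsPercolation μ p I)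
    (r D : ℝ) (hr : r = 1 / (M : ℝ)) (hD : D = FractalPercolation.dimension d M p)
    (k : Fin (d + 1)) (hk : ((k : ℕ) : ℝ) < D) :
    -- all the expectations are well defined
    (∀ n : ℕ,
      Integrable (fun ω => FractalPercolation.intrinsicVolume k
        (FractalPercolation.complSet I n ω)) μ) ∧
    (∀ T : Finset (FractalPercolation.Label d M), 2 ≤ T.card → ∀ n : ℕ,
      Integrable (fun ω => FractalPercolation.intrinsicVolume k
        (⋂ j ∈ T, FractalPercolation.complPart I (n + 1) j ω)) μ) ∧
    -- all the series converge (absolutely)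
    (∀ T : Finset (FractalPercolation.Label d M), 2 ≤ T.card →
      Summable (fun n : ℕ => r ^ (((n + 1 : ℕ) : ℝ) * (D - ((k : ℕ) : ℝ))) *
        ∫ ω, FractalPercolation.intrinsicVolume k
          (⋂ j ∈ T, FractalPercolation.complPart I (n + 1) j ω) ∂μ)) ∧
    -- the limit exists and is given by the formula
    Tendsto (fun n : ℕ => r ^ ((n : ℝ) * (D - ((k : ℕ) : ℝ))) *
        ∫ ω, FractalPercolation.intrinsicVolume k (FractalPercolation.complSet I n ω) ∂μ)
      atTop
      (𝓝 (FractalPercolation.intrinsicVolume k (FractalPercolation.unitCube d) *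
            ((M : ℝ) ^ (d - (k : ℕ)) * (1 - p) / ((M : ℝ) ^ (d - (k : ℕ)) * p - 1)) +
          ∑ T : Finset (FractalPercolation.Label d M) with 2 ≤ T.card,
            (-1 : ℝ) ^ (T.card - 1) *
              ∑' n : ℕ, r ^ (((n + 1 : ℕ) : ℝ) * (D - ((k : ℕ) : ℝ))) *
                ∫ ω, FractalPercolation.intrinsicVolume k
                  (⋂ j ∈ T, FractalPercolation.complPart I (n + 1) j ω) ∂μ)) := by
  subst hr hD
  have hM0 : 0 < M := by omega
  have hM' : (0 : ℝ) < M := by exact_mod_cast hM0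
  have hp0 : 0 < p := lt_trans (by positivity) hp
  have hpow : ∀ n : ℕ,
      (1 / (M : ℝ)) ^ ((n : ℝ) * (FractalPercolation.dimension d M p - ((k : ℕ) : ℝ))) =
        ((M : ℝ) ^ (d - (k : ℕ)) * p)⁻¹ ^ n := fun n => by
    rw [mul_comm, Real.rpow_mul (by positivity), FractalPercolation.rpow_dimension_sub hM hp0,
      Real.rpow_natCast]
  simp only [hpow, FractalPercolation.complSet_eq_removedSet hM0]
  exact ⟨fun n => hI.integrable_intrinsicVolume_removedSet n k,
    fun T _ n => hI.integrable_intrinsicVolume_iInter_complPart (n + 1) T k,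
    fun T hT => hI.summable_integral_iInter_complPart hM hp hp1 hk T hT,
    hI.tendsto_integral_intrinsicVolume_removedSet hM hp hp1 hk rfl⟩
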